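/- Let $X=(L,\alpha,\beta)$ be a smooth nonhomogeneous projective horospherical variety of Picard number one. By Pasquier's classification, with simple roots $\alpha_j$ and fundamental weights $\pi_j$ numbered as in Bourbaki and $V(\pi)$ the irreducible representation of highest weight $\pi$, the triple and the representation $U$ are one of: $(B_m,\alpha_{m-1},\alpha_m)$, $m\ge 3$, $U=V(\pi_m)$; $(B_3,\alpha_1,\alpha_3)$, $U=V(\pi_3)$; $(C_m,\alpha_{i+1},\alpha_i)$, $m\ge 2$, $1\le i\le m-1$, $U=V(\pi_1)$ (the types $i=m-1$ and $i<m-1$ being distinguished in the six-type list); $(F_4,\alpha_2,\alpha_3)$ with $\alpha_1,\alpha_2$ long, $U=V(\pi_4)$; $(G_2,\alpha_2,\alpha_1)$ with $\alpha_2$ long, $U=V(\pi_1)$. Let $\mathfrak l$ be the complex semisimple Lie algebra of the given type, with a Cartan subalgebra $\mathfrak h$ and a base of simple roots. The Lie algebra $\mathfrak g=\mathfrak{aut}(X)$ is the semidirect product $(\mathfrak l\oplus\mathbb C)\rhd U$, in which $U$ is an abelian ideal, $\mathfrak l$ acts on $U$ by the given representation, $c\in\mathbb C$ acts on $U$ as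 multiplication by $c$, and $[\mathfrak l,\mathbb C]=0$. Let $E_\alpha\in\mathfrak h$ be the characteristic element of $\alpha$, i.e. $\alpha(E_\alpha)=1$ and $\alpha_j(E_\alpha)=0$ for all simple roots $\alpha_j\neq\alpha$. Let $\mathfrak l_k$ and $U_k$ be the eigenspaces of $E_\alpha$ on $\mathfrak l$ and on $U$ with eigenvalue $k$, let $\mu(U)$ be the largest nonzero eigenvalue of $E_\alpha$ on $U$, and put $U_{\tilde i}=U_{-\mu(U)+1+i}$ for integers $i$, $U_-=U_{\widetilde{-1}}=U_{-\mu(U)}$. Set $$\mathfrak g_p=\mathfrak l_p\ (p<-1),\qquad \mathfrak g_{-1}=\mathfrak l_{-1}+U_-,\qquad \mathfrak g_0=\mathfrak l_0+\mathbb C+U_{\tilde 0},\qquad \mathfrak g_p=\mathfrak l_p+U_{\tilde p}\ (p\ge 1),$$ and $\mathfrak m=\bigoplus_{p<0}\mathfrak g_p$, $\mathfrak g_{\ge 0}=\bigoplus_{p\ge 0}\mathfrak g_p$, $\mathfrak l_{\ge 0}=\bigoplus_{p\ge 0}\mathfrak l_p$, $U_{\ge\tilde 0}=\bigoplus_{i\ge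 0}U_{\tilde i}$. Then $\mathfrak g=\bigoplus_{p\in\mathbb Z}\mathfrak g_p$ is a graded Lie algebra (that is, a direct sum with $[\mathfrak g_p,\mathfrak g_q]\subset\mathfrak g_{p+q}$), and: 1. $\mathfrak m$ is fundamental: it is a nilpotent Lie subalgebra, and $\mathfrak g_p=[\mathfrak g_{p+1},\mathfrak g_{-1}]$ for all $p<-1$. 2. If $z\in\mathfrak l_{\ge 0}+U_{\ge\tilde 0}$ satisfies $[z,\mathfrak l_{-1}]=0$, then $z=0$. If $z\in\mathfrak g_{\ge 0}$ satisfies $[z,\mathfrak g_{-1}]=0$, then $z=0$. 3. For every nonzero $u\in U_{\tilde 0}$, the subspace $[\mathfrak l_{-1},u]$ is contained in $U_-$ and has dimension at least $2$. -/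

import Mathlib

namespace Horospherical

open LieAlgebra LieAlgebra.IsKilling

noncomputable section

/-! ### The list of triples -/

/-- The smooth nonhomogeneous projective horospherical varieties `X = (L, α, β)` of Picard number
one, recorded by the Cartan matrix of `L` (with `A i j = ⟨αᵢ, αⱼ^∨⟩`), the nodes `α`, `β` of its
Dynkin diagram, and the node `ω` such that the unipotent radical of `Aut X` is `U = V(π_ω)`.
Nodes are numbered as in Bourbaki, but starting from `0`. -/
inductive IsTriple : {m : ℕ} → Matrix (Fin m) (Fin m) ℤ → Fin m → Fin m → Fin m → Prop
  /-- `(B_m, α_{m-1}, α_m)`, `m ≥ 3`, `U = V(π_m)` (spin representation). -/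
  | typeB (m : ℕ) (hm : 3 ≤ m) :
      IsTriple (CartanMatrix.B m) ⟨m - 2, by omega⟩ ⟨m - 1, by omega⟩ ⟨m - 1, by omega⟩
  /-- `(B_3, α_1, α_3)`, `U = V(π_3)` (spin representation). -/
  | typeB3 : IsTriple (CartanMatrix.B 3) 0 2 2
  /-- `(C_m, α_{i+1}, α_i)`, `m ≥ 2`, `1 ≤ i ≤ m - 1`, `U = V(π_1)`; here `i = k + 1`. -/
  | typeC (m k : ℕ) (hk : k + 1 < m) :
      IsTriple (CartanMatrix.C m) ⟨k + 1, hk⟩ ⟨k, by omega⟩ ⟨0, by omega⟩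
  /-- `(F_4, α_2, α_3)`, `α_2` long, `U = V(π_4)` (of dimension 26). -/
  | typeF4 : IsTriple CartanMatrix.F₄ 1 2 3
  /-- `(G_2, α_2, α_1)`, `α_1` short and `α_2` long, `U = V(π_1)` (of dimension 7).
  Mathlib's matrix `G₂` has the first root long, whence the transpose. -/
  | typeG2 : IsTriple (CartanMatrix.G₂.transpose) 1 0 0

/-! ### The Lie algebra `(𝔩 + ℂ) ▷ U` -/

set_option linter.unusedSectionVars false

section AutAlgebra

/-- The Lie algebra `𝔤 = (𝔩 + ℂ) ▷ U`; its elements are written `l + c + u`. -/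
@[ext]
structure Aut (𝔩 U : Type*) where
  /-- The component in `𝔩`. -/
  l : 𝔩
  /-- The component in `ℂ`. -/
  c : ℂ
  /-- The component in `U`. -/
  u : U

variable (𝔩 U : Type*) [LieRing 𝔩] [LieAlgebra ℂ 𝔩]
  [AddCommGroup U] [Module ℂ U] [LieRingModule 𝔩 U] [LieModule ℂ 𝔩 U]

/-- The space underlying `𝔤` is `𝔩 ⊕ ℂ ⊕ U`. -/
def Aut.equivProd : Aut 𝔩 U ≃ 𝔩 × ℂ × U where
  toFun x := (x.l, x.c, x.u)
  invFun x := ⟨x.1, x.2.1, x.2.2⟩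
  left_inv _ := rfl
  right_inv _ := rfl

instance : AddCommGroup (Aut 𝔩 U) := (Aut.equivProd 𝔩 U).addCommGroup

instance : Module ℂ (Aut 𝔩 U) := (Aut.equivProd 𝔩 U).module ℂ

variable {𝔩 U}

/-- The bracket of `(𝔩 + ℂ) ▷ U`: `U` is an abelian ideal on which `𝔩` acts by its representation
and `c ∈ ℂ` acts as the scalar `c`, and `ℂ` commutes with `𝔩`. It is the commutator of the block
matrices with diagonal blocks `l`, `l + c` and lower left block `u`. -/
instance : Bracket (Aut 𝔩 U) (Aut 𝔩 U) where
  bracket x y := ⟨⁅x.l, y.l⁆, 0, (⁅x.l, y.u⁆ - ⁅y.l, x.u⁆) + (x.c • y.u - y.c • x.u)⟩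

@[simp] theorem lie_l (x y : Aut 𝔩 U) : ⁅x, y⁆.l = ⁅x.l, y.l⁆ := rfl

@[simp] theorem lie_c (x y : Aut 𝔩 U) : ⁅x, y⁆.c = 0 := rfl

@[simp] theorem lie_u (x y : Aut 𝔩 U) :
    ⁅x, y⁆.u = (⁅x.l, y.u⁆ - ⁅y.l, x.u⁆) + (x.c • y.u - y.c • x.u) := rfl

@[simp] theorem add_l (x y : Aut 𝔩 U) : (x + y).l = x.l + y.l := rfl

@[simp] theorem add_c (x y : Aut 𝔩 U) : (x + y).c = x.c + y.c := rfl

@[simp] theorem add_u (x y : Aut 𝔩 U) : (x + y).u = x.u + y.u := rfl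

@[simp] theorem zero_l : (0 : Aut 𝔩 U).l = 0 := rfl

@[simp] theorem zero_c : (0 : Aut 𝔩 U).c = 0 := rfl

@[simp] theorem zero_u : (0 : Aut 𝔩 U).u = 0 := rfl

@[simp] theorem smul_l (t : ℂ) (x : Aut 𝔩 U) : (t • x).l = t • x.l := rfl

@[simp] theorem smul_c (t : ℂ) (x : Aut 𝔩 U) : (t • x).c = t * x.c := rfl

@[simp] theorem smul_u (t : ℂ) (x : Aut 𝔩 U) : (t • x).u = t • x.u := rfl

instance : LieRing (Aut 𝔩 U) where
  add_lie x y z := by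
    ext <;> simp [add_smul]
    abel
  lie_add x y z := by
    ext <;> simp [add_smul]
    abel
  lie_self x := by
    ext <;> simp
  leibniz_lie x y z := by
    ext
    · simp
    · simp
    · simp only [lie_l, lie_c, lie_u, add_u, lie_add, lie_sub, lie_smul, lie_lie, smul_add,
        smul_sub, zero_smul]
      rw [smul_comm x.c y.c z.u, smul_comm x.c z.c y.u, smul_comm y.c z.c x.u]
      abel

instance : LieAlgebra ℂ (Aut 𝔩 U) where
  lie_smul t x y := by
    ext
    · simp
    · simp
    · simp [smul_add, smul_sub, mul_smul, smul_comm t]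

variable (𝔩 U)

/-- The inclusion `𝔩 ⊂ 𝔤`. -/
def inL : 𝔩 →ₗ[ℂ] Aut 𝔩 U where
  toFun l := ⟨l, 0, 0⟩
  map_add' _ _ := by ext <;> simp
  map_smul' _ _ := by ext <;> simp

/-- The inclusion `ℂ ⊂ 𝔤`. -/
def inC : ℂ →ₗ[ℂ] Aut 𝔩 U where
  toFun c := ⟨0, c, 0⟩
  map_add' _ _ := by ext <;> simp
  map_smul' _ _ := by ext <;> simp

/-- The inclusion `U ⊂ 𝔤`. -/
def inU : U →ₗ[ℂ] Aut 𝔩 U where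
  toFun u := ⟨0, 0, u⟩
  map_add' _ _ := by ext <;> simp
  map_smul' _ _ := by ext <;> simp

end AutAlgebra

/-! ### Gradations of Lie algebras -/

section Gradation

variable {𝔤 : Type*} [LieRing 𝔤] [LieAlgebra ℂ 𝔤]

/-- `[A, B]`: the span of the brackets of elements of `A` with elements of `B`. -/
def bracketSpan (A B : Submodule ℂ 𝔤) : Submodule ℂ 𝔤 :=
  Submodule.span ℂ {z | ∃ x ∈ A, ∃ y ∈ B, ⁅x, y⁆ = z}

/-- `𝔤 = ⨁ₚ 𝔤ₚ` is a gradation of the Lie algebra `𝔤`. -/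
def IsGradation (g : ℤ → Submodule ℂ 𝔤) : Prop :=
  DirectSum.IsInternal g ∧ ∀ p q : ℤ, ∀ x ∈ g p, ∀ y ∈ g q, ⁅x, y⁆ ∈ g (p + q)

/-- The negative part `𝔪 = ⨁_{p < 0} 𝔤ₚ` of a gradation is fundamental: it is a nilpotent Lie
subalgebra, and it is generated by `𝔤₋₁` in the sense that `𝔤ₚ = [𝔤ₚ₊₁, 𝔤₋₁]` for `p < -1`. -/
def IsFundamental (g : ℤ → Submodule ℂ 𝔤) : Prop :=
  (∃ 𝔪 : LieSubalgebra ℂ 𝔤,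
    𝔪.toSubmodule = ⨆ p : {p : ℤ // p < 0}, g p ∧ LieRing.IsNilpotent 𝔪) ∧
  ∀ p : ℤ, p < -1 → g p = bracketSpan (g (p + 1)) (g (-1))

end Gradation

/-! ### Characteristic elements and the gradation of `(𝔩 + ℂ) ▷ U` -/

section Grading

variable {𝔩 : Type*} [LieRing 𝔩] [LieAlgebra ℂ 𝔩] [FiniteDimensional ℂ 𝔩]
  [LieAlgebra.IsSemisimple ℂ 𝔩] {H : LieSubalgebra ℂ 𝔩} [H.IsCartanSubalgebra]

/-- The characteristic element `E_{αᵢ} ∈ 𝔥` of a simple root `αᵢ`: the basis of `𝔥` dual to the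
basis of simple roots of `𝔥^*`. -/
def charElt (b : (rootSystem H).Base) (i : b.support) : H :=
  (Module.evalEquiv ℂ H).symm (b.toWeightBasis.coord i)

/-- `αⱼ(E_{αᵢ}) = δᵢⱼ`. -/
theorem root_charElt (b : (rootSystem H).Base) (i j : b.support) :
    (rootSystem H).root j (charElt b i) = Finsupp.single j (1 : ℂ) i := by
  rw [charElt, Module.apply_evalEquiv_symm_apply, Module.Basis.coord_apply,
    RootPairing.Base.toWeightBasis_repr_root]

/-- `U` is the irreducible representation `V(πᵢ)` of `𝔩`, whose highest weight is the fundamental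
weight `πᵢ` (defined by `πᵢ(αⱼ^∨) = δᵢⱼ`). -/
def IsFundamentalRep (b : (rootSystem H).Base) (i : b.support)
    (U : Type*) [AddCommGroup U] [Module ℂ U] [LieRingModule 𝔩 U] [LieModule ℂ 𝔩 U] : Prop :=
  LieModule.IsIrreducible ℂ 𝔩 U ∧
  ∃ v : U, v ≠ 0 ∧
    (∀ j : b.support, ∀ x ∈ rootSpace H ((rootSystem H).root j), ⁅x, v⁆ = 0) ∧
    ⁅(((rootSystem H).coroot i : H) : 𝔩), v⁆ = v ∧
    ∀ j : b.support, j ≠ i → ⁅(((rootSystem H).coroot j : H) : 𝔩), v⁆ = 0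

variable (U : Type*) [AddCommGroup U] [Module ℂ U] [LieRingModule 𝔩 U] [LieModule ℂ 𝔩 U]
  (E : H)

/-- `𝔩ₖ`: the eigenspace of the action of `E` on `𝔩` with eigenvalue `k`. -/
def lPart (k : ℤ) : Submodule ℂ 𝔩 := (LieAlgebra.ad ℂ 𝔩 (E : 𝔩)).eigenspace (k : ℂ)

/-- `Uₖ`: the eigenspace of the action of `E` on `U` with eigenvalue `k` (not always an integer). -/
def uPart (k : ℝ) : Submodule ℂ U := (LieModule.toEnd ℂ 𝔩 U (E : 𝔩)).eigenspace (k : ℂ)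

/-- `μ(U)`: the largest number among the nonzero eigenvalues of `E` on `U`. -/
def mu : ℝ :=
  sSup {r : ℝ | r ≠ 0 ∧ (LieModule.toEnd ℂ 𝔩 U (E : 𝔩)).HasEigenvalue (r : ℂ)}

/-- The shifted gradation: `U_{ĩ} = U_{-μ(U)+1+i}`, so that `U₋ = U_{-μ(U)}` has index `-1`. -/
def uTilde (i : ℤ) : Submodule ℂ U := uPart U E (-mu U E + 1 + i)

/-- The pieces of the gradation of `𝔤 = (𝔩 + ℂ) ▷ U`: `𝔤ₚ = 𝔩ₚ` for `p < -1`,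
`𝔤₋₁ = 𝔩₋₁ + U₋`, `𝔤₀ = (𝔩₀ + ℂ) + U_{0̃}`, and `𝔤ₚ = 𝔩ₚ + U_{p̃}` for `p ≥ 1`. -/
def gPart (p : ℤ) : Submodule ℂ (Aut 𝔩 U) :=
  if p < -1 then (lPart E p).map (inL 𝔩 U)
  else if p = 0 then
    (lPart E 0).map (inL 𝔩 U) ⊔ LinearMap.range (inC 𝔩 U) ⊔ (uTilde U E 0).map (inU 𝔩 U)
  else (lPart E p).map (inL 𝔩 U) ⊔ (uTilde U E p).map (inU 𝔩 U)

/-- `𝔤_{≥0} = ⨁_{p ≥ 0} 𝔤ₚ`. -/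
def gNonneg : Submodule ℂ (Aut 𝔩 U) := ⨆ p : {p : ℤ // 0 ≤ p}, gPart U E p

/-- `𝔩_{≥0} + U_{≥0̃}`. -/
def luNonneg : Submodule ℂ (Aut 𝔩 U) :=
  (⨆ p : {p : ℤ // 0 ≤ p}, lPart E p).map (inL 𝔩 U) ⊔
    (⨆ i : {i : ℤ // 0 ≤ i}, uTilde U E i).map (inU 𝔩 U)

end Grading

end

end Horospherical

/-!
The whole argument takes place in the gradation of `𝔩` and of the irreducible module `U` by the
characteristic element `E` of `α`. Besides the commutation relations of `𝔩` it uses three properties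
of the triples: the Dynkin diagram is connected, so that `𝔩` is simple
(`isIrreducible_of_connected`); the Weyl group contains `-1`
(`HasOrthogonalRoots.negOneMemWeyl`); and `α` is not the node `ω` of the highest weight of `U`.

*The spectrum of `E` on `U`.* Let `ϖ` be the highest weight of `U` and `a = ϖ(E)`. Raising or
lowering an extremal vector shows that all degrees of `U` lie in `a - ℕ` (`iSup_eig_eq_top`).
Since the weights are stable under the Weyl group, hence under `-1`, the degrees also lie in
`-a + ℕ`. As `𝔩` is simple, `E` does not act by zero, so `a` is a positive half-integer equal
to `μ(U)`. With this, `𝔤ₚ` is the eigenspace with eigenvalue `p` of the adjoint action of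
`E + (a - 1) ∈ 𝔩 + ℂ` (`gPart_eq_eigenspace`), which makes `𝔤` a graded Lie algebra
(`isGradation_gPart`).

*The negative part.* If `γ`, `δ` and `γ + δ` are roots then `[𝔩_γ, 𝔩_δ] = 𝔩_{γ + δ}`. Since a
positive root that is not simple is the sum of a positive root and a simple one, this yields
`𝔩ₚ = [𝔩ₚ₊₁, 𝔩₋₁]` for `p < -1` (`lPart_le_bracketSpan`). The negative part of any gradation of
a finite-dimensional Lie algebra is nilpotent by Engel's theorem
(`IsGradation.exists_isNilpotent`).

*Transitivity.* A vector of an irreducible module killed by `𝔩₋₁` is killed by all `𝔩ₚ` with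
`p < 0`, hence generates the module by raising its degree, and so it has the lowest degree of all
(`lowKer_le`). For `U` this degree is `-a`, and for the adjoint module it is negative; so nothing of
nonnegative degree is killed by `𝔩₋₁`.

*The dimension of `[𝔩₋₁, u]`.* Suppose that it is at most one for some `u ≠ 0` of degree `-a + 1`.
The condition is closed and invariant under the Borel subalgebra of `𝔩₀`, so that `u` may be
assumed to be killed by the negative root vectors of the simple roots other than `α`
(`RankLeOne.exists_lowest`; nilpotent elements suffice, one at a time). If `(h, e, f)` is the
`𝔰𝔩₂`-triple of `α`, then `w = f u` spans `[𝔩₋₁, u]`, and it follows that `w` is a lowest weight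
vector of `U`. Its weight is `-ϖ`, which vanishes on `h` because `α` is not the node `ω`; thus
`e w = 0`. Then `u` has weight `2` under `h`, although `f u` has weight `0` and is killed by `e`;
this is impossible in a finite-dimensional representation of `𝔰𝔩₂` (`not_rankLeOne`).
-/

namespace Horospherical

open LieAlgebra LieAlgebra.IsKilling LieModule

noncomputable section

set_option linter.unusedSectionVars false

variable {𝔩 : Type*} [LieRing 𝔩] [LieAlgebra ℂ 𝔩] [FiniteDimensional ℂ 𝔩]
  [LieAlgebra.IsSemisimple ℂ 𝔩] {H : LieSubalgebra ℂ 𝔩} [H.IsCartanSubalgebra]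

section Eigenspaces

/-! ### Eigenspaces of an element of the Cartan subalgebra -/

/-- If the subspaces `W i` span the whole space and consist of eigenvectors of eigenvalue `c i`,
then an eigenspace is spanned by the `W i` having that eigenvalue. -/
lemma eigenspace_le_iSup {ι V : Type*} [AddCommGroup V] [Module ℂ V] (f : Module.End ℂ V)
    (W : ι → Submodule ℂ V) (c : ι → ℂ) (hW : ∀ i, W i ≤ f.eigenspace (c i))
    (htop : ⨆ i, W i = ⊤) (t : ℂ) :
    f.eigenspace t ≤ ⨆ (i : ι) (_ : c i = t), W i := by
  intro x hx
  have hx' : x ∈ (⨆ (i : ι) (_ : c i = t), W i) ⊔ ⨆ (i : ι) (_ : ¬ c i = t), W i := by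
    rw [← iSup_split, htop]
    trivial
  obtain ⟨y, hy, z, hz, rfl⟩ := Submodule.mem_sup.1 hx'
  have hy' : y ∈ f.eigenspace t :=
    (iSup₂_le fun i hi => hi ▸ hW i : (⨆ (i : ι) (_ : c i = t), W i) ≤ _) hy
  have hz' : z ∈ ⨆ (s : ℂ) (_ : s ≠ t), f.eigenspace s :=
    (iSup₂_le fun i hi => le_iSup₂_of_le (c i) hi (hW i) :
      (⨆ (i : ι) (_ : ¬ c i = t), W i) ≤ _) hz
  have hz'' : z ∈ f.eigenspace t := by simpa using sub_mem hx hy'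
  have := (Submodule.disjoint_def.1 (f.eigenspaces_iSupIndep t)) z hz'' hz'
  rw [this, add_zero]
  exact hy

variable (V : Type*) [AddCommGroup V] [Module ℂ V] [LieRingModule 𝔩 V] [LieModule ℂ 𝔩 V]

/-- The eigenspace with eigenvalue `c` of an element `E` of the Cartan subalgebra acting on an
`𝔩`-module. For `V = 𝔩` and `V = U` these are the spaces `lPart` and `uPart`, but with
arbitrary complex eigenvalues. -/
abbrev eig (E : H) (c : ℂ) : Submodule ℂ V := (toEnd ℂ 𝔩 V (E : 𝔩)).eigenspace c

variable {V}

lemma mem_eig {E : H} {c : ℂ} {v : V} : v ∈ eig V E c ↔ ⁅(E : 𝔩), v⁆ = c • v := by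
  rw [Module.End.mem_eigenspace_iff, toEnd_apply_apply]

lemma mem_lPart {E : H} {k : ℤ} {x : 𝔩} : x ∈ lPart E k ↔ ⁅(E : 𝔩), x⁆ = (k : ℂ) • x :=
  mem_eig

lemma eig_neg (E : H) (c : ℂ) : eig V (-E) c = eig V E (-c) := by
  ext v
  rw [mem_eig, mem_eig, NegMemClass.coe_neg, neg_lie, neg_eq_iff_eq_neg, neg_smul]

lemma lPart_neg (E : H) (k : ℤ) : lPart (-E) k = lPart E (-k) := by
  ext v
  rw [mem_lPart, mem_lPart, NegMemClass.coe_neg, neg_lie, neg_eq_iff_eq_neg, Int.cast_neg,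
    neg_smul]

lemma lie_mem_eig {E : H} {k : ℤ} {c : ℂ} {x : 𝔩} {v : V} (hx : x ∈ lPart E k)
    (hv : v ∈ eig V E c) : ⁅x, v⁆ ∈ eig V E (c + k) := by
  rw [mem_eig] at hv ⊢
  rw [mem_lPart] at hx
  rw [leibniz_lie, hx, hv, smul_lie, lie_smul, ← add_smul, add_comm]

lemma lie_mem_lPart {E : H} {k n : ℤ} {x y : 𝔩} (hx : x ∈ lPart E k) (hy : y ∈ lPart E n) :
    ⁅x, y⁆ ∈ lPart E (k + n) := by
  have := lie_mem_eig (V := 𝔩) (c := n) hx hy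
  rw [add_comm k n]
  change _ ∈ eig 𝔩 E _
  exact_mod_cast this

/-- An irreducible module is generated from a lowest weight vector by raising its degree: if `v`
has degree `a` and is killed by the elements of `𝔩` of negative degree, then all degrees occurring
lie in `a + ℕ`. The subspace generated by `v` under the elements of nonnegative degree is stable
under all of `𝔩`. -/
theorem iSup_eig_eq_top [IsIrreducible ℂ 𝔩 V] {E : H} (hE : ⨆ k : ℤ, lPart E k = ⊤)
    {a : ℂ} {v : V} (hv : v ∈ eig V E a) (hv0 : v ≠ 0)
    (hlow : ∀ k : ℤ, k < 0 → ∀ x ∈ lPart E k, ⁅x, v⁆ = 0) :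
    ⨆ n : ℕ, eig V E (a + n) = ⊤ := by
  -- `Q` is the smallest subspace containing `v` and stable under the nonnegative part of `𝔩`. The
  -- elements of `Q` that the negative part maps into `Q` form a subspace `Q'` of the same kind, so
  -- that `Q` is a submodule.
  let P : Submodule ℂ V → Prop := fun S =>
    v ∈ S ∧ ∀ k : ℤ, 0 ≤ k → ∀ x ∈ lPart E k, ∀ s ∈ S, ⁅x, s⁆ ∈ S
  let Q : Submodule ℂ V := sInf {S | P S}
  have hvQ : v ∈ Q := Submodule.mem_sInf.2 fun S hS => hS.1
  have hQ : ∀ k : ℤ, 0 ≤ k → ∀ x ∈ lPart E k, ∀ s ∈ Q, ⁅x, s⁆ ∈ Q := fun k hk x hx s hs =>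
    Submodule.mem_sInf.2 fun S hS => hS.2 k hk x hx s (Submodule.mem_sInf.1 hs S hS)
  let Q' : Submodule ℂ V :=
    { carrier := {q | q ∈ Q ∧ ∀ k : ℤ, k < 0 → ∀ x ∈ lPart E k, ⁅x, q⁆ ∈ Q}
      add_mem' := fun {p q} hp hq => ⟨add_mem hp.1 hq.1, fun k hk x hx => by
        rw [lie_add]; exact add_mem (hp.2 k hk x hx) (hq.2 k hk x hx)⟩
      zero_mem' := ⟨zero_mem _, fun k hk x hx => by simp⟩
      smul_mem' := fun c q hq => ⟨Q.smul_mem c hq.1, fun k hk x hx => by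
        rw [lie_smul]; exact Q.smul_mem c (hq.2 k hk x hx)⟩ }
  have hQ' : P Q' := by
    refine ⟨⟨hvQ, fun k hk x hx => by rw [hlow k hk x hx]; exact zero_mem _⟩, ?_⟩
    intro k hk y hy q hq
    refine ⟨hQ k hk y hy q hq.1, fun n hn x hx => ?_⟩
    rw [leibniz_lie]
    refine add_mem ?_ (hQ k hk y hy _ (hq.2 n hn x hx))
    have hxy := lie_mem_lPart hx hy
    rcases lt_or_ge (n + k) 0 with h | h
    · exact hq.2 _ h _ hxy
    · exact hQ _ h _ hxy _ hq.1
  have hQQ' : Q ≤ Q' := sInf_le hQ'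
  let N : LieSubmodule ℂ 𝔩 V :=
    { Q with
      lie_mem := by
        intro x q hq
        have hx : x ∈ ⨆ k : ℤ, lPart E k := hE ▸ trivial
        change ⁅x, q⁆ ∈ Q
        induction hx using Submodule.iSup_induction' with
        | mem k x hx =>
          rcases lt_or_ge k 0 with h | h
          · exact (hQQ' hq).2 k h x hx
          · exact hQ k h x hx q hq
        | zero => simp
        | add x y _ _ hx hy => rw [add_lie]; exact add_mem hx hy }
  have hN : N = ⊤ := by
    refine (eq_bot_or_eq_top N).resolve_left fun h => hv0 ?_
    have : v ∈ N := hvQ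
    rwa [h, LieSubmodule.mem_bot] at this
  have hT : P (⨆ n : ℕ, eig V E (a + n)) := by
    refine ⟨Submodule.mem_iSup_of_mem 0 (by simpa using hv), ?_⟩
    intro k hk x hx s hs
    induction hs using Submodule.iSup_induction' with
    | mem n s hs =>
      refine Submodule.mem_iSup_of_mem (n + k.toNat) ?_
      have := lie_mem_eig hx hs
      have hk' : ((k.toNat : ℤ) : ℂ) = k := by rw [Int.toNat_of_nonneg hk]
      push_cast at hk' ⊢
      rwa [hk', ← add_assoc]
    | zero => simp
    | add x y _ _ hx hy => rw [lie_add]; exact add_mem hx hy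
  rw [eq_top_iff]
  intro u _
  have : u ∈ N := hN ▸ trivial
  exact (sInf_le hT : Q ≤ _) this

/-- If the eigenspaces with eigenvalue `t i` span, then every eigenvalue is one of the `t i`. -/
lemma exists_eq_of_eig_ne_bot {ι : Type*} {E : H} {t : ι → ℂ} (htop : ⨆ i, eig V E (t i) = ⊤)
    {c : ℂ} (hc : eig V E c ≠ ⊥) : ∃ i, c = t i := by
  by_contra! h
  apply hc
  have := eigenspace_le_iSup (toEnd ℂ 𝔩 V (E : 𝔩)) _ t (fun i => le_rfl) htop c
  rw [eq_bot_iff]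
  refine this.trans (iSup₂_le fun i hi => absurd hi.symm (h i))

lemma iSup_eig_eq_top_of_iSup {ι : Type*} {E : H} {t : ι → ℂ}
    (htop : ⨆ i, eig V E (t i) = ⊤) : ⨆ c, eig V E c = ⊤ :=
  eq_top_iff.2 (htop ▸ iSup_le fun i => le_iSup (fun c => eig V E c) (t i))

variable (V) in
/-- The vectors killed by the elements of `𝔩` of degree `-1`. -/
def lowKer (E : H) : Submodule ℂ V where
  carrier := {v | ∀ x ∈ lPart E (-1), ⁅x, v⁆ = 0}
  add_mem' hp hq x hx := by rw [lie_add, hp x hx, hq x hx, add_zero]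
  zero_mem' x _ := lie_zero x
  smul_mem' c v hv x hx := by rw [lie_smul, hv x hx, smul_zero]

/-- If `𝔩₋₁` generates the negative part of `𝔩`, the vectors of an irreducible module killed by
`𝔩₋₁` have degree at most any degree that occurs. -/
theorem lowKer_le [FiniteDimensional ℂ V] [IsIrreducible ℂ 𝔩 V] {E : H}
    (hE : ⨆ k : ℤ, lPart E k = ⊤)
    (hgen : ∀ v ∈ lowKer V E, ∀ k : ℤ, k < 0 → ∀ x ∈ lPart E k, ⁅x, v⁆ = 0)
    (hdiag : ⨆ c, eig V E c = ⊤) {t : ℂ} (ht : eig V E t ≠ ⊥) :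
    lowKer V E ≤ ⨆ n : ℕ, eig V E (t - n) := by
  have hstab : ∀ v ∈ lowKer V E, toEnd ℂ 𝔩 V (E : 𝔩) v ∈ lowKer V E := by
    intro v hv x hx
    rw [toEnd_apply_apply, leibniz_lie, hv x hx, lie_zero, add_zero, ← lie_skew,
      mem_lPart.1 hx]
    simp [hv x hx]
  rw [Submodule.eq_iSup_inf_genEigenspace 1 hstab hdiag]
  refine iSup_le fun c => ?_
  rintro v ⟨hv, hvc⟩
  by_cases hv0 : v = 0
  · rw [hv0]; exact zero_mem _
  obtain ⟨n, hn⟩ := exists_eq_of_eig_ne_bot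
    (iSup_eig_eq_top hE hvc hv0 (hgen v hv)) ht
  refine Submodule.mem_iSup_of_mem n ?_
  have : t - n = c := by rw [hn]; ring
  rw [this]
  exact hvc

end Eigenspaces

section RootSpaces

/-! ### Brackets of root spaces -/

lemma rootSpace_le_lPart {χ : H → ℂ} {E : H} {k : ℤ} (h : χ E = k) :
    (rootSpace H χ).toSubmodule ≤ lPart E k := by
  intro x hx
  rw [mem_lPart, ← h]
  exact lie_eq_smul_of_mem_rootSpace hx E

/-- If `α`, `β` and `α + β` are roots then `[𝔩_α, 𝔩_β] = 𝔩_{α+β}`. -/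
theorem exists_lie_eq_of_root_add {i j k : H.root}
    (hk : (rootSystem H).root k = (rootSystem H).root i + (rootSystem H).root j) {z : 𝔩}
    (hz : z ∈ rootSpace H ((rootSystem H).root k)) :
    ∃ x ∈ rootSpace H ((rootSystem H).root i), ∃ y ∈ rootSpace H ((rootSystem H).root j),
      ⁅x, y⁆ = z := by
  set α : Weight ℂ H 𝔩 := i.1
  set β : Weight ℂ H 𝔩 := j.1
  set γ : Weight ℂ H 𝔩 := k.1
  have hα : α.IsNonZero := H.isNonZero_coe_root i
  have hγ : γ.IsNonZero := H.isNonZero_coe_root k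
  have hsum : (γ : H → ℂ) = α + β := by
    funext h
    exact congrArg (fun φ : Module.Dual ℂ H => φ h) hk
  have hq : 1 ≤ chainTopCoeff α β := by
    have := (rootSpace_zsmul_add_ne_bot_iff α β hα 1).1 (by
      rw [one_smul, ← hsum]; exact γ.genWeightSpace_ne_bot)
    exact_mod_cast this.1
  obtain ⟨x, hx, hx0⟩ := (chainTop α β).exists_ne_zero
  obtain ⟨h, e, f, t, he, hf⟩ := exists_isSl2Triple_of_weight_isNonZero hα
  obtain rfl := t.h_eq_coroot hα he hf
  have prim : t.HasPrimitiveVectorWith x (chainLength α β : ℂ) :=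
    { ne_zero := hx0
      lie_h := (chainLength_smul α β hx).symm
      lie_e := by
        rw [← LieSubmodule.mem_bot (R := ℂ) (L := H),
          ← genWeightSpace_add_chainTop α β hα]
        exact lie_mem_genWeightSpace_of_mem_genWeightSpace he hx }
  obtain ⟨q, hq'⟩ := Nat.exists_eq_add_of_le' hq
  have hql : q + 1 ≤ chainLength α β := hq' ▸ chainTopCoeff_le_chainLength α β
  have hy : ((toEnd ℂ 𝔩 𝔩 f) ^ (q + 1)) x ∈ rootSpace H β := by
    have := toEnd_pow_apply_mem hf hx (q + 1)
    convert this using 2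
    rw [coe_chainTop', hq', smul_neg]
    abel
  have hey := prim.lie_e_pow_succ_toEnd_f q
  have hne : ⁅e, ((toEnd ℂ 𝔩 𝔩 f) ^ (q + 1)) x⁆ ≠ 0 := by
    rw [hey]
    refine smul_ne_zero (mul_ne_zero (by exact_mod_cast q.succ_ne_zero) ?_)
      (prim.pow_toEnd_f_ne_zero_of_eq_nat rfl (by lia))
    rw [sub_ne_zero]
    exact_mod_cast (by lia : chainLength α β ≠ q)
  have hmem : ⁅e, ((toEnd ℂ 𝔩 𝔩 f) ^ (q + 1)) x⁆ ∈ rootSpace H γ := by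
    rw [hsum]
    exact lie_mem_genWeightSpace_of_mem_genWeightSpace he hy
  obtain ⟨c, hc⟩ := (finrank_eq_one_iff_of_nonzero'
    (⟨_, hmem⟩ : rootSpace H γ) (by simpa using hne)).1
    (finrank_rootSpace_eq_one γ hγ) ⟨z, hz⟩
  refine ⟨c • e, (rootSpace H _).smul_mem c he, _, hy, ?_⟩
  rw [smul_lie]
  exact congrArg Subtype.val hc

/-! ### The gradation defined by a characteristic element -/

variable (b : (rootSystem H).Base)

/-- The value of a positive root at a characteristic element is a coefficient of the root in the
basis of simple roots, hence a natural number. -/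
lemma exists_root_charElt_eq_natCast (s : b.support) {i : H.root} (hi : b.IsPos i) :
    ∃ n : ℕ, (rootSystem H).root i (charElt b s) = n := by
  classical
  refine hi.induction_on_add (p := fun i => ∃ n : ℕ, (rootSystem H).root i (charElt b s) = n)
    (fun i hi => ?_) (fun i j k hk hi hj => ?_)
  · rw [root_charElt b s ⟨i, hi⟩, Finsupp.single_apply]
    split_ifs
    · exact ⟨1, by simp⟩
    · exact ⟨0, by simp⟩
  · obtain ⟨n, hn⟩ := hi
    rw [hk, LinearMap.add_apply, hn, root_charElt b s ⟨j, hj⟩, Finsupp.single_apply]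
    split_ifs
    · exact ⟨n + 1, by simp⟩
    · exact ⟨n, by simp⟩

/-- Every root is positive or the negative of a positive root. -/
lemma isPos_or_exists_neg (i : H.root) :
    b.IsPos i ∨ ∃ j, b.IsPos j ∧ (rootSystem H).root i = -(rootSystem H).root j := by
  let := (rootSystem H).indexNeg
  refine (RootPairing.Base.IsPos.or_neg b i).imp_right fun h => ⟨-i, h, ?_⟩
  rw [RootPairing.indexNeg_neg, RootPairing.root_reflectionPerm, RootPairing.reflection_apply_self,
    neg_neg]

lemma exists_root_neg (i : H.root) : ∃ j, (rootSystem H).root j = -(rootSystem H).root i := by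
  let := (rootSystem H).indexNeg
  exact ⟨-i, by rw [RootPairing.indexNeg_neg, RootPairing.root_reflectionPerm,
    RootPairing.reflection_apply_self]⟩

/-- A subalgebra containing the root spaces of the simple roots contains those of all positive
roots. -/
lemma rootSpace_le_of_isPos (S : LieSubalgebra ℂ 𝔩)
    (hS : ∀ j ∈ b.support, ∀ x ∈ rootSpace H ((rootSystem H).root j), x ∈ S)
    {i : H.root} (hi : b.IsPos i) : ∀ x ∈ rootSpace H ((rootSystem H).root i), x ∈ S := by
  refine hi.induction_on_add hS (fun i j k hk hi hj => ?_)
  · intro z hz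
    obtain ⟨x, hx, y, hy, rfl⟩ := exists_lie_eq_of_root_add hk hz
    exact S.lie_mem (hi x hx) (hS j hj y hy)

/-- A subalgebra containing the root spaces of the negatives of the simple roots contains those of
all negative roots. -/
lemma rootSpace_neg_le_of_isPos (S : LieSubalgebra ℂ 𝔩)
    (hS : ∀ j ∈ b.support, ∀ x ∈ rootSpace H (-(rootSystem H).root j : Module.Dual ℂ H), x ∈ S)
    {i : H.root} (hi : b.IsPos i) :
    ∀ x ∈ rootSpace H (-(rootSystem H).root i : Module.Dual ℂ H), x ∈ S := by
  refine hi.induction_on_add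
    (p := fun i => ∀ x ∈ rootSpace H (-(rootSystem H).root i : Module.Dual ℂ H), x ∈ S)
    hS (fun i j k hk hi hj => ?_)
  · intro z hz
    obtain ⟨i', hi'⟩ := exists_root_neg i
    obtain ⟨j', hj'⟩ := exists_root_neg j
    obtain ⟨k', hk'⟩ := exists_root_neg k
    rw [← hk'] at hz
    obtain ⟨x, hx, y, hy, rfl⟩ := exists_lie_eq_of_root_add (i := i') (j := j')
      (by rw [hk', hi', hj', hk]; abel) hz
    rw [hi'] at hx
    rw [hj'] at hy
    exact S.lie_mem (hi x hx) (hS j hj y hy)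

lemma iSup_rootSpace_eq_top :
    ⨆ χ : Weight ℂ H 𝔩, (rootSpace H χ).toSubmodule = ⊤ := by
  rw [← LieSubmodule.iSup_toSubmodule, iSup_genWeightSpace_eq_top' ℂ H 𝔩]
  rfl

/-- The part of degree `k` of `𝔩` is spanned by the root spaces of degree `k` (including
`𝔥`, the root space of the weight zero). -/
lemma lPart_le_iSup_rootSpace (E : H) (k : ℤ) :
    lPart E k ≤ ⨆ (χ : Weight ℂ H 𝔩) (_ : χ E = k), (rootSpace H χ).toSubmodule :=
  eigenspace_le_iSup (toEnd ℂ 𝔩 𝔩 (E : 𝔩)) _ (fun χ : Weight ℂ H 𝔩 => χ E)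
    (fun _ _ hx => Module.End.mem_eigenspace_iff.2 (lie_eq_smul_of_mem_rootSpace hx E))
    iSup_rootSpace_eq_top k

/-- A submodule containing the root spaces of all negative roots contains the negative part of the
gradation defined by a characteristic element. -/
lemma lPart_charElt_le_of_neg (s : b.support) {k : ℤ} (hk : k < 0) (S : Submodule ℂ 𝔩)
    (hS : ∀ i, b.IsPos i → (rootSystem H).root i (charElt b s) = (-k : ℤ) →
      ∀ x ∈ rootSpace H (-(rootSystem H).root i : Module.Dual ℂ H), x ∈ S) :
    lPart (charElt b s) k ≤ S := by
  refine (lPart_le_iSup_rootSpace _ _).trans (iSup₂_le fun χ hχ x hx => ?_)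
  have hχ0 : χ.IsNonZero := by
    intro h
    rw [h.eq, Pi.zero_apply] at hχ
    exact hk.ne (by exact_mod_cast hχ.symm)
  have hmem : χ ∈ H.root := by simpa [LieSubalgebra.root] using hχ0
  have hχ' : (rootSystem H).root ⟨χ, hmem⟩ (charElt b s) = k := hχ
  rcases isPos_or_exists_neg b ⟨χ, hmem⟩ with h | ⟨j, hj, hj'⟩
  · obtain ⟨n, hn⟩ := exists_root_charElt_eq_natCast b s h
    rw [hn] at hχ'
    have : (n : ℤ) = k := by exact_mod_cast hχ'
    lia
  · refine hS j hj ?_ x ?_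
    · rw [hj', LinearMap.neg_apply] at hχ'
      rw [← neg_eq_iff_eq_neg.2 hχ'.symm]
      simp
    · rw [← hj']
      exact hx

/-- The counterpart of `lPart_charElt_le_of_neg` for the positive part. -/
lemma lPart_charElt_le_of_pos (s : b.support) {k : ℤ} (hk : 0 < k) (S : Submodule ℂ 𝔩)
    (hS : ∀ i, b.IsPos i → ∀ x ∈ rootSpace H ((rootSystem H).root i), x ∈ S) :
    lPart (charElt b s) k ≤ S := by
  refine (lPart_le_iSup_rootSpace _ _).trans (iSup₂_le fun χ hχ x hx => ?_)
  have hχ0 : χ.IsNonZero := by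
    intro h
    rw [h.eq, Pi.zero_apply] at hχ
    exact hk.ne (by exact_mod_cast hχ)
  have hmem : χ ∈ H.root := by simpa [LieSubalgebra.root] using hχ0
  have hχ' : (rootSystem H).root ⟨χ, hmem⟩ (charElt b s) = k := hχ
  rcases isPos_or_exists_neg b ⟨χ, hmem⟩ with h | ⟨j, hj, hj'⟩
  · exact hS _ h x hx
  · obtain ⟨n, hn⟩ := exists_root_charElt_eq_natCast b s hj
    rw [hj', LinearMap.neg_apply, hn] at hχ'
    have : (-n : ℤ) = k := by exact_mod_cast hχ'
    lia

/-- A characteristic element acts on `𝔩` with integral eigenvalues. -/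
lemma iSup_lPart_charElt (s : b.support) : ⨆ k : ℤ, lPart (charElt b s) k = ⊤ := by
  rw [eq_top_iff, ← iSup_rootSpace_eq_top (H := H)]
  refine iSup_le fun χ => ?_
  by_cases hχ0 : χ.IsZero
  · exact le_iSup_of_le 0 (rootSpace_le_lPart (by rw [hχ0.eq]; simp))
  have hmem : χ ∈ H.root := by simpa [LieSubalgebra.root] using hχ0
  rcases isPos_or_exists_neg b ⟨χ, hmem⟩ with h | ⟨j, hj, hj'⟩
  · obtain ⟨n, hn⟩ := exists_root_charElt_eq_natCast b s h
    exact le_iSup_of_le (n : ℤ) (rootSpace_le_lPart (by exact_mod_cast hn))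
  · obtain ⟨n, hn⟩ := exists_root_charElt_eq_natCast b s hj
    refine le_iSup_of_le (-n : ℤ) (rootSpace_le_lPart ?_)
    have : χ (charElt b s) = (rootSystem H).root ⟨χ, hmem⟩ (charElt b s) := rfl
    rw [this, hj', LinearMap.neg_apply, hn]
    simp

lemma rootSpace_neg_le_lPart_self (s : b.support) :
    (rootSpace H (-(rootSystem H).root s : Module.Dual ℂ H)).toSubmodule ≤
      lPart (charElt b s) (-1) := by
  refine rootSpace_le_lPart ?_
  rw [LinearMap.neg_apply, root_charElt, Finsupp.single_eq_same]
  simp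

lemma rootSpace_neg_le_lPart_of_ne {s j : b.support} (h : j ≠ s) :
    (rootSpace H (-(rootSystem H).root j : Module.Dual ℂ H)).toSubmodule ≤
      lPart (charElt b s) 0 := by
  refine rootSpace_le_lPart ?_
  rw [LinearMap.neg_apply, root_charElt, Finsupp.single_eq_of_ne h.symm]
  simp

/-- The negative part of the gradation is generated by its part of degree `-1`. -/
theorem lPart_le_bracketSpan (s : b.support) {k : ℤ} (hk : k < -1) :
    lPart (charElt b s) k ≤ bracketSpan (lPart (charElt b s) (k + 1))
      (lPart (charElt b s) (-1)) := by
  classical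
  refine lPart_charElt_le_of_neg b s (by lia) _ ?_
  intro i hi
  refine hi.induction_on_add
    (p := fun i => (rootSystem H).root i (charElt b s) = (-k : ℤ) →
      ∀ x ∈ rootSpace H (-(rootSystem H).root i : Module.Dual ℂ H),
        x ∈ bracketSpan (lPart (charElt b s) (k + 1)) (lPart (charElt b s) (-1)))
    (fun i hi => ?_) (fun i j l hl hi hj => ?_)
  · intro h
    rw [root_charElt b s ⟨i, hi⟩, Finsupp.single_apply] at h
    split_ifs at h
    · have : (1 : ℤ) = -k := by exact_mod_cast h
      lia
    · have : (0 : ℤ) = -k := by exact_mod_cast h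
      lia
  · intro h z hz
    obtain ⟨i', hi'⟩ := exists_root_neg i
    obtain ⟨j', hj'⟩ := exists_root_neg j
    obtain ⟨l', hl'⟩ := exists_root_neg l
    rw [← hl'] at hz
    obtain ⟨x, hx, y, hy, rfl⟩ := exists_lie_eq_of_root_add (i := i') (j := j')
      (by rw [hl', hi', hj', hl]; abel) hz
    rw [hi'] at hx
    rw [hj'] at hy
    rw [hl, LinearMap.add_apply] at h
    by_cases hjs : (⟨j, hj⟩ : b.support) = s
    · have hyp : y ∈ lPart (charElt b s) (-1) := by
        subst hjs
        exact rootSpace_neg_le_lPart_self b ⟨j, hj⟩ hy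
      rw [root_charElt b s ⟨j, hj⟩, hjs, Finsupp.single_eq_same] at h
      refine Submodule.subset_span ⟨x, ?_, y, hyp, rfl⟩
      refine rootSpace_le_lPart ?_ hx
      rw [LinearMap.neg_apply, eq_sub_of_add_eq h]
      push_cast
      ring
    · have hyp : y ∈ lPart (charElt b s) 0 := rootSpace_neg_le_lPart_of_ne b hjs hy
      rw [root_charElt b s ⟨j, hj⟩, Finsupp.single_eq_of_ne (Ne.symm hjs), add_zero] at h
      have hx' := hi h x hx
      clear hx hi hz
      -- `𝔩₀` acts on `[𝔩ₖ₊₁, 𝔩₋₁]` by derivations.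
      induction hx' using Submodule.span_induction with
      | mem x hx =>
        obtain ⟨p, hp, q, hq, rfl⟩ := hx
        rw [lie_lie, ← lie_skew q ⁅p, y⁆, sub_neg_eq_add]
        refine add_mem (Submodule.subset_span ⟨p, hp, _, ?_, rfl⟩) ?_
        · simpa using lie_mem_lPart hq hyp
        · refine Submodule.subset_span ⟨_, ?_, q, hq, rfl⟩
          simpa using lie_mem_lPart hp hyp
      | zero => simp
      | add x y _ _ hx hy => rw [add_lie]; exact add_mem hx hy
      | smul c x _ hx => rw [smul_lie]; exact Submodule.smul_mem _ c hx

section Module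

variable {V : Type*} [AddCommGroup V] [Module ℂ V] [LieRingModule 𝔩 V] [LieModule ℂ 𝔩 V]

/-- The subalgebra of elements killing a vector. -/
def stabilizer (v : V) : LieSubalgebra ℂ 𝔩 where
  carrier := {x | ⁅x, v⁆ = 0}
  add_mem' {x y} hx hy := by
    change ⁅x + y, v⁆ = 0
    change ⁅x, v⁆ = 0 at hx
    change ⁅y, v⁆ = 0 at hy
    rw [add_lie, hx, hy, add_zero]
  zero_mem' := zero_lie v
  smul_mem' c x hx := by
    change ⁅c • x, v⁆ = 0
    change ⁅x, v⁆ = 0 at hx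
    rw [smul_lie, hx, smul_zero]
  lie_mem' {x y} hx hy := by
    change ⁅x, v⁆ = 0 at hx
    change ⁅y, v⁆ = 0 at hy
    change ⁅⁅x, y⁆, v⁆ = 0
    rw [lie_lie, hx, hy, lie_zero, lie_zero, sub_zero]

/-- A vector killed by the part of degree `-1` is killed by the whole negative part. -/
lemma lie_eq_zero_of_mem_lowKer (s : b.support) {v : V} (hv : v ∈ lowKer V (charElt b s)) {k : ℤ}
    (hk : k < 0) : ∀ x ∈ lPart (charElt b s) k, ⁅x, v⁆ = 0 := by
  obtain ⟨n, rfl⟩ : ∃ n : ℕ, k = -1 - n := ⟨(-1 - k).toNat, by lia⟩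
  clear hk
  change lPart (charElt b s) _ ≤ (stabilizer v).toSubmodule
  induction n with
  | zero =>
    rw [Nat.cast_zero, sub_zero]
    exact hv
  | succ n ih =>
    refine (lPart_le_bracketSpan b s (by lia)).trans (Submodule.span_le.2 ?_)
    rintro _ ⟨x, hx, y, hy, rfl⟩
    refine (stabilizer v).lie_mem (ih ?_) (hv y hy)
    convert hx using 2
    push_cast
    ring

end Module

end RootSpaces

section Weyl

/-! ### Simplicity -/

/-- A semisimple Lie algebra whose Dynkin diagram is connected is simple. Connectedness says that a
nonempty set of nodes containing all neighbours of its members contains all nodes. -/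
theorem isIrreducible_of_connected (b : (rootSystem H).Base) [Nonempty b.support]
    (hconn : ∀ p : b.support → Prop, (∃ i, p i) →
      (∀ i j, p i → b.cartanMatrix j i ≠ 0 → p j) → ∀ i, p i) :
    IsIrreducible ℂ 𝔩 𝔩 := by
  obtain ⟨i₀⟩ := ‹Nonempty b.support›
  have : Nontrivial 𝔩 := by
    obtain ⟨x, -, hx⟩ := (i₀ : H.root).1.exists_ne_zero
    exact ⟨x, 0, hx⟩
  refine IsIrreducible.mk fun (I : LieIdeal ℂ 𝔩) hI => ?_
  have key : ∀ α β : H.root, α ∈ I.rootSet → (rootSystem H).pairing β α ≠ 0 → β ∈ I.rootSet :=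
    fun α β hα hβ => I.rootSpace_le_of_apply_coroot_ne_zero hα hβ
  have hpair : ∀ (j : b.support) (α : H.root), (rootSystem H).pairingIn ℤ j α ≠ 0 →
      (rootSystem H).pairing j α ≠ 0 := fun j α h h' => h <| by
    rw [← (rootSystem H).algebraMap_pairingIn ℤ] at h'
    simpa using h'
  obtain ⟨α, hα⟩ : ∃ α, α ∈ I.rootSet := by
    by_contra h
    apply hI
    have : I.restr H = ⊥ := by
      rw [I.restr_eq_iSup_sl2SubmoduleOfRoot (H := H), eq_bot_iff]
      exact iSup₂_le fun α hα => absurd ⟨α, hα⟩ h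
    rw [← LieSubmodule.toSubmodule_eq_bot, ← LieSubmodule.restr_toSubmodule I H, this,
      LieSubmodule.bot_toSubmodule]
  obtain ⟨j, hj, hjα⟩ := RootPairing.Base.exists_mem_support_pos_pairingIn_ne_zero (b := b) α
  have hsimple : ∀ i : b.support, (i : H.root) ∈ I.rootSet := by
    refine hconn (fun i => (i : H.root) ∈ I.rootSet)
      ⟨⟨j, hj⟩, key α j hα (hpair ⟨j, hj⟩ α hjα)⟩ fun i j hi hij => ?_
    exact key _ _ hi (hpair j i hij)
  have hall : I.rootSet (H := H) = Set.univ := by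
    refine Set.eq_univ_of_forall fun β => ?_
    obtain ⟨j, hj, hjβ⟩ := RootPairing.Base.exists_mem_support_pos_pairingIn_ne_zero (b := b) β
    refine key j β (hsimple ⟨j, hj⟩) fun h => hpair ⟨j, hj⟩ β hjβ ?_
    exact (rootSystem H).pairing_eq_zero_iff.1 h
  have htop : (⊤ : LieIdeal ℂ 𝔩).rootSet (H := H) = Set.univ :=
    Set.eq_univ_of_forall fun β x _ => by simp
  have h1 := I.restr_eq_iSup_sl2SubmoduleOfRoot (H := H)
  have h2 := (⊤ : LieIdeal ℂ 𝔩).restr_eq_iSup_sl2SubmoduleOfRoot (H := H)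
  rw [hall] at h1
  rw [htop, ← h1] at h2
  rw [← LieSubmodule.toSubmodule_inj, ← LieSubmodule.restr_toSubmodule I H, ← h2,
    LieSubmodule.restr_toSubmodule]

/-! ### Weights of a module and the Weyl group -/

section Weights

variable {V : Type*} [AddCommGroup V] [Module ℂ V] [LieRingModule 𝔩 V] [LieModule ℂ 𝔩 V]

lemma mem_weightSpace' {χ : H → ℂ} {v : V} :
    v ∈ weightSpace V χ ↔ ∀ h : H, ⁅(h : 𝔩), v⁆ = χ h • v :=
  mem_weightSpace χ v

lemma weightSpace_ne_bot_iff {χ : H → ℂ} :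
    weightSpace V χ ≠ ⊥ ↔ ∃ v ∈ weightSpace V χ, v ≠ 0 := by
  rw [ne_eq, ← LieSubmodule.toSubmodule_eq_bot, ← ne_eq, Submodule.ne_bot_iff]
  rfl

lemma lie_mem_weightSpace {χ ψ : H → ℂ} {x : 𝔩} {v : V} (hx : x ∈ rootSpace H ψ)
    (hv : v ∈ weightSpace V χ) : ⁅x, v⁆ ∈ weightSpace V (χ + ψ) := by
  rw [mem_weightSpace'] at hv ⊢
  intro h
  have hx' : ⁅(h : 𝔩), x⁆ = ψ h • x := lie_eq_smul_of_mem_rootSpace hx h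
  rw [leibniz_lie, hx', hv, smul_lie, lie_smul, ← add_smul, add_comm, Pi.add_apply]

lemma toEnd_pow_mem_weightSpace {χ ψ : H → ℂ} {x : 𝔩} {v : V} (hx : x ∈ rootSpace H ψ)
    (hv : v ∈ weightSpace V χ) (k : ℕ) :
    ((toEnd ℂ 𝔩 V x) ^ k) v ∈ weightSpace V (χ + k • ψ) := by
  induction k with
  | zero => simpa using hv
  | succ k ih =>
    rw [pow_succ', Module.End.mul_apply, toEnd_apply_apply, succ_nsmul, ← add_assoc]
    exact lie_mem_weightSpace hx ih

lemma weightSpace_le_eig (χ : H → ℂ) (E : H) :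
    (weightSpace V χ).toSubmodule ≤ eig V E (χ E) :=
  fun _ hv => mem_eig.2 (mem_weightSpace'.1 hv E)

/-- The value of a weight `χ` at a coroot is an integer `z`; if it is nonnegative then `χ - z α` is
again a weight. It is obtained by going up the `α`-string as far as possible and then down. -/
lemma exists_int_weightSpace_sub_ne_bot [FiniteDimensional ℂ V] {χ : Module.Dual ℂ H}
    (hχ : weightSpace V χ ≠ ⊥) (i : H.root) :
    ∃ z : ℤ, χ ((rootSystem H).coroot i) = z ∧
      (0 ≤ z → weightSpace V (χ - z • (rootSystem H).root i : Module.Dual ℂ H) ≠ ⊥) := by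
  obtain ⟨v, hv, hv0⟩ := weightSpace_ne_bot_iff.1 hχ
  have hα : i.1.IsNonZero := H.isNonZero_coe_root i
  obtain ⟨h, e, f, t, he, hf⟩ := exists_isSl2Triple_of_weight_isNonZero hα
  obtain rfl := t.h_eq_coroot hα he hf
  obtain ⟨k, hk, hk'⟩ := Nat.exists_not_and_succ_of_not_zero_of_exists
    (p := fun n => ((toEnd ℂ 𝔩 V e) ^ n) v = 0) (by simpa using hv0) (by
      obtain ⟨n, hn⟩ := isNilpotent_toEnd_of_mem_rootSpace V H (χ := i.1)
        (fun h0 => hα h0) he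
      exact ⟨n, by rw [hn, LinearMap.zero_apply]⟩)
  have hw := toEnd_pow_mem_weightSpace he hv k
  set w := ((toEnd ℂ 𝔩 V e) ^ k) v
  have prim : t.HasPrimitiveVectorWith w (χ (coroot i.1) + 2 * k) :=
    { ne_zero := hk
      lie_h := by
        rw [mem_weightSpace'.1 hw]
        congr 1
        rw [Pi.add_apply, Pi.smul_apply, root_apply_coroot hα, nsmul_eq_mul, mul_comm]
      lie_e := by
        rw [← hk', pow_succ', Module.End.mul_apply, toEnd_apply_apply] }
  obtain ⟨n, hn⟩ := prim.exists_nat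
  refine ⟨n - 2 * k, ?_, fun hz => ?_⟩
  · rw [rootSystem_coroot_apply, eq_sub_of_add_eq hn]
    push_cast
    ring
  · have hkn : n - k ≤ n := Nat.sub_le _ _
    rw [weightSpace_ne_bot_iff]
    refine ⟨_, ?_, prim.pow_toEnd_f_ne_zero_of_eq_nat hn hkn⟩
    have := toEnd_pow_mem_weightSpace hf hw (n - k)
    convert this using 2
    funext x
    have hkn' : ((n - k : ℕ) : ℂ) = n - k := by
      rw [Nat.cast_sub (by lia)]
    simp only [LinearMap.sub_apply, LinearMap.smul_apply, rootSystem_root_apply,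
      Weight.toLinear_apply, Pi.add_apply, Pi.smul_apply, Pi.neg_apply]
    simp only [nsmul_eq_mul, zsmul_eq_mul, hkn']
    push_cast
    ring

/-- The set of weights of a finite-dimensional module is stable under the Weyl group. -/
theorem weightSpace_reflection_ne_bot [FiniteDimensional ℂ V] {χ : Module.Dual ℂ H}
    (hχ : weightSpace V χ ≠ ⊥) (i : H.root) :
    weightSpace V ((rootSystem H).reflection i χ) ≠ ⊥ := by
  have hrefl : (rootSystem H).reflection i χ =
      χ - χ ((rootSystem H).coroot i) • (rootSystem H).root i := by
    rw [RootPairing.reflection_apply]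
    rfl
  obtain ⟨z, hz, hz'⟩ := exists_int_weightSpace_sub_ne_bot hχ i
  rcases le_total 0 z with h | h
  · rw [hrefl, hz, Int.cast_smul_eq_zsmul]
    exact hz' h
  · let := (rootSystem H).indexNeg
    obtain ⟨y, hy, hy'⟩ := exists_int_weightSpace_sub_ne_bot hχ (-i)
    have h1 : (rootSystem H).root (-i) = -(rootSystem H).root i := by
      rw [RootPairing.indexNeg_neg, RootPairing.root_reflectionPerm,
        RootPairing.reflection_apply_self]
    have h2 : (rootSystem H).coroot (-i) = -(rootSystem H).coroot i := by
      rw [RootPairing.indexNeg_neg, RootPairing.coroot_reflectionPerm,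
        RootPairing.coreflection_apply_self]
    have hyz : y = -z := by
      rw [h2, map_neg, hz] at hy
      exact_mod_cast hy.symm
    subst hyz
    have := hy' (by lia)
    rwa [h1, smul_neg, neg_smul, neg_neg, ← Int.cast_smul_eq_zsmul ℂ, ← hz, ← hrefl] at this

/-- An irreducible module having a weight is the sum of its weight spaces. -/
lemma iSup_weightSpace_eq_top [IsIrreducible ℂ 𝔩 V] {χ : Module.Dual ℂ H}
    (hχ : weightSpace V χ ≠ ⊥) :
    ⨆ ψ : Module.Dual ℂ H, (weightSpace V ψ).toSubmodule = ⊤ := by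
  let N : LieSubmodule ℂ 𝔩 V :=
    { (⨆ ψ : Module.Dual ℂ H, (weightSpace V ψ).toSubmodule) with
      lie_mem := by
        intro x v hv
        change v ∈ ⨆ ψ : Module.Dual ℂ H, (weightSpace V ψ).toSubmodule at hv
        change ⁅x, v⁆ ∈ ⨆ ψ : Module.Dual ℂ H, (weightSpace V ψ).toSubmodule
        have hx : x ∈ ⨆ χ : Weight ℂ H 𝔩, (rootSpace H χ).toSubmodule :=
          iSup_rootSpace_eq_top (H := H) ▸ trivial
        induction hx using Submodule.iSup_induction' with
        | mem α x hx =>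
          induction hv using Submodule.iSup_induction' with
          | mem ψ v hv =>
            exact Submodule.mem_iSup_of_mem (ψ + α.toLinear) (lie_mem_weightSpace hx hv)
          | zero => simp
          | add u v _ _ hu hv => rw [lie_add]; exact add_mem hu hv
        | zero => simp
        | add x y _ _ hx hy => rw [add_lie]; exact add_mem hx hy }
  have hN : N = ⊤ := by
    refine (eq_bot_or_eq_top N).resolve_left fun h => hχ ?_
    rw [eq_bot_iff]
    intro v hv
    have : v ∈ N := Submodule.mem_iSup_of_mem χ hv
    rwa [h, LieSubmodule.mem_bot] at this
  exact congrArg LieSubmodule.toSubmodule hN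

variable (H) in
/-- The Weyl group contains `-1`, expressed through the subsets of `𝔥^*` stable under the
reflections. -/
def NegOneMemWeyl : Prop :=
  ∀ X : Set (Module.Dual ℂ H), (∀ i, ∀ χ ∈ X, (rootSystem H).reflection i χ ∈ X) →
    ∀ χ ∈ X, -χ ∈ X

/-- If the Weyl group contains `-1`, the spectrum of an element of the Cartan subalgebra on an
irreducible module having a weight is symmetric. -/
lemma eig_neg_ne_bot [FiniteDimensional ℂ V] [IsIrreducible ℂ 𝔩 V] (hneg : NegOneMemWeyl H)
    {χ : Module.Dual ℂ H} (hχ : weightSpace V χ ≠ ⊥) (E : H) {c : ℂ} (hc : eig V E c ≠ ⊥) :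
    eig V E (-c) ≠ ⊥ := by
  have h := eigenspace_le_iSup (toEnd ℂ 𝔩 V (E : 𝔩))
    (fun ψ : Module.Dual ℂ H => (weightSpace V ψ).toSubmodule) (fun ψ => ψ E)
    (fun ψ => weightSpace_le_eig ψ E) (iSup_weightSpace_eq_top hχ) c
  obtain ⟨ψ, rfl, hψ⟩ : ∃ ψ : Module.Dual ℂ H, ψ E = c ∧ weightSpace V ψ ≠ ⊥ := by
    by_contra hcon
    refine hc (eq_bot_iff.2 (h.trans (iSup₂_le fun ψ hψ => ?_)))
    by_contra hψ'
    refine hcon ⟨ψ, hψ, fun h0 => hψ' ?_⟩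
    exact ((LieSubmodule.toSubmodule_eq_bot _).2 h0).le
  have hψ' : weightSpace V (-ψ : Module.Dual ℂ H) ≠ ⊥ :=
    hneg (Set.ofPred fun ψ => weightSpace V ψ ≠ ⊥)
      (fun i ψ h => weightSpace_reflection_ne_bot h i) ψ hψ
  obtain ⟨v, hv, hv0⟩ := weightSpace_ne_bot_iff.1 hψ'
  refine (Submodule.ne_bot_iff _).2 ⟨v, mem_eig.2 ?_, hv0⟩
  rw [mem_weightSpace'.1 hv E, LinearMap.neg_apply]

end Weights

end Weyl

section Spectrum

/-! ### The spectrum of a characteristic element on an irreducible module -/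

variable (b : (rootSystem H).Base)
variable {V : Type*} [AddCommGroup V] [Module ℂ V] [LieRingModule 𝔩 V] [LieModule ℂ 𝔩 V]

variable (V) in
/-- `ϖ` is the weight of a vector of `V` killed by the root spaces of the positive roots. -/
def IsHighestWeight (ϖ : Module.Dual ℂ H) : Prop :=
  ∃ v ∈ weightSpace V ϖ, v ≠ 0 ∧
    ∀ i, b.IsPos i → ∀ x ∈ rootSpace H ((rootSystem H).root i), ⁅x, v⁆ = 0

lemma exists_isHighestWeight {i : b.support} (hV : IsFundamentalRep b i V) :
    ∃ ϖ : Module.Dual ℂ H, IsHighestWeight b V ϖ ∧ ϖ ((rootSystem H).coroot i) = 1 ∧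
      ∀ j : b.support, j ≠ i → ϖ ((rootSystem H).coroot j) = 0 := by
  classical
  obtain ⟨-, v, hv0, hv, hvi, hvj⟩ := hV
  have hϖ (j : b.support) : b.toCoweightBasis.coord i ((rootSystem H).coroot j) =
      if j = i then 1 else 0 := by
    rw [Module.Basis.coord_apply, RootPairing.Base.toCoweightBasis_repr_coroot,
      Finsupp.single_apply]
  refine ⟨b.toCoweightBasis.coord i, ⟨v, ?_, hv0, fun k hk => ?_⟩, ?_, fun j hj => ?_⟩
  · rw [mem_weightSpace']
    have : (toEnd ℂ 𝔩 V : 𝔩 →ₗ[ℂ] Module.End ℂ V).flip v ∘ₗ H.toSubmodule.subtype =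
        (b.toCoweightBasis.coord i).smulRight v := by
      refine b.toCoweightBasis.ext fun j => ?_
      have hj : b.toCoweightBasis j = (rootSystem H).coroot j := by simp
      rw [hj, LinearMap.smulRight_apply, hϖ]
      change ⁅(((rootSystem H).coroot j : H) : 𝔩), v⁆ = _
      split_ifs with h
      · rw [h, hvi, one_smul]
      · rw [hvj j h, zero_smul]
    exact fun h => LinearMap.congr_fun this h
  · exact rootSpace_le_of_isPos b (stabilizer v) (fun j hj x hx => hv ⟨j, hj⟩ x hx) hk
  · rw [hϖ, if_pos rfl]
  · rw [hϖ, if_neg hj]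

variable {b} {ϖ : Module.Dual ℂ H}

namespace IsHighestWeight

lemma weightSpace_ne_bot (hϖ : IsHighestWeight b V ϖ) : weightSpace V ϖ ≠ ⊥ := by
  obtain ⟨v, hv, hv0, -⟩ := hϖ
  exact weightSpace_ne_bot_iff.2 ⟨v, hv, hv0⟩

lemma eig_ne_bot (hϖ : IsHighestWeight b V ϖ) (E : H) : eig V E (ϖ E) ≠ ⊥ := by
  obtain ⟨v, hv, hv0, -⟩ := hϖ
  exact (Submodule.ne_bot_iff _).2 ⟨v, weightSpace_le_eig ϖ E hv, hv0⟩

variable [IsIrreducible ℂ 𝔩 V] (s : b.support)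

/-- The degrees of an irreducible module lie below that of the highest weight vector. -/
lemma iSup_eig_sub_eq_top (hϖ : IsHighestWeight b V ϖ) :
    ⨆ n : ℕ, eig V (charElt b s) (ϖ (charElt b s) - n) = ⊤ := by
  obtain ⟨v, hv, hv0, hpos⟩ := hϖ
  have hE : ⨆ k : ℤ, lPart (-charElt b s) k = ⊤ := by
    rw [eq_top_iff, ← iSup_lPart_charElt b s]
    refine iSup_le fun k => le_iSup_of_le (-k) ?_
    rw [lPart_neg, neg_neg]
  have hv' : v ∈ eig V (-charElt b s) (-ϖ (charElt b s)) := by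
    rw [eig_neg, neg_neg]
    exact weightSpace_le_eig ϖ _ hv
  have := iSup_eig_eq_top hE hv' hv0 fun k hk x hx => by
    rw [lPart_neg] at hx
    exact lPart_charElt_le_of_pos b s (k := -k) (by lia) (stabilizer v).toSubmodule hpos hx
  rw [eq_top_iff, ← this]
  refine iSup_mono fun n => ?_
  rw [eig_neg, neg_add, neg_neg, ← sub_eq_add_neg]

variable [FiniteDimensional ℂ V]

lemma exists_eq_sub (hϖ : IsHighestWeight b V ϖ) {c : ℂ} (hc : eig V (charElt b s) c ≠ ⊥) :
    ∃ n : ℕ, c = ϖ (charElt b s) - n :=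
  exists_eq_of_eig_ne_bot (hϖ.iSup_eig_sub_eq_top s) hc

lemma exists_eq_neg_add (hϖ : IsHighestWeight b V ϖ) (hneg : NegOneMemWeyl H) {c : ℂ}
    (hc : eig V (charElt b s) c ≠ ⊥) : ∃ n : ℕ, c = -ϖ (charElt b s) + n := by
  obtain ⟨n, hn⟩ := hϖ.exists_eq_sub s (eig_neg_ne_bot hneg hϖ.weightSpace_ne_bot _ hc)
  exact ⟨n, by linear_combination -hn⟩

lemma eig_neg_sub_eq_bot (hϖ : IsHighestWeight b V ϖ) (hneg : NegOneMemWeyl H) {n : ℤ}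
    (hn : 0 < n) : eig V (charElt b s) (-ϖ (charElt b s) - n) = ⊥ := by
  by_contra h
  obtain ⟨k, hk⟩ := hϖ.exists_eq_neg_add s hneg h
  have : (-n : ℤ) = k := by
    have h2 : -(n : ℂ) = k := by linear_combination hk
    exact_mod_cast h2
  lia

/-- If `-1` is in the Weyl group, the degrees of an irreducible module lie above the opposite of
the degree of the highest weight vector. -/
lemma iSup_eig_neg_add_eq_top (hϖ : IsHighestWeight b V ϖ) (hneg : NegOneMemWeyl H) :
    ⨆ n : ℕ, eig V (charElt b s) (-ϖ (charElt b s) + n) = ⊤ := by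
  rw [eq_top_iff, ← iSup_eig_eq_top_of_iSup (hϖ.iSup_eig_sub_eq_top s)]
  refine iSup_le fun c => ?_
  by_cases hc : eig V (charElt b s) c = ⊥
  · rw [hc]; exact bot_le
  · obtain ⟨n, rfl⟩ := hϖ.exists_eq_neg_add s hneg hc
    exact le_iSup (fun n : ℕ => eig V (charElt b s) (-ϖ (charElt b s) + n)) n

/-- The value of a nonzero highest weight at a characteristic element is a positive half-integer.
It is nonzero because `𝔩` is simple. -/
lemma exists_apply_charElt_eq (hϖ : IsHighestWeight b V ϖ) (hneg : NegOneMemWeyl H)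
    (hirr : IsIrreducible ℂ 𝔩 𝔩) (hϖ0 : ϖ ≠ 0) :
    ∃ N : ℕ, 0 < N ∧ ϖ (charElt b s) = N / 2 := by
  obtain ⟨N, hN⟩ := hϖ.exists_eq_sub s
    (eig_neg_ne_bot hneg hϖ.weightSpace_ne_bot _ (hϖ.eig_ne_bot (charElt b s)))
  have hN' : ϖ (charElt b s) = N / 2 := by linear_combination -hN / 2
  refine ⟨N, Nat.pos_of_ne_zero fun h0 => hϖ0 ?_, hN'⟩
  have hz : ϖ (charElt b s) = 0 := by rw [hN', h0]; simp
  -- All degrees are zero, so that the kernel of the representation contains `charElt b s`.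
  have htop : eig V (charElt b s) 0 = ⊤ := by
    rw [eq_top_iff, ← hϖ.iSup_eig_sub_eq_top s]
    refine iSup_le fun n => ?_
    by_cases hn : eig V (charElt b s) (ϖ (charElt b s) - n) = ⊥
    · rw [hn]; exact bot_le
    · obtain ⟨k, hk⟩ := hϖ.exists_eq_neg_add s hneg hn
      rw [hz] at hk
      have : ((n + k : ℕ) : ℂ) = 0 := by push_cast; linear_combination -hk
      have : n = 0 := by
        have : n + k = 0 := by exact_mod_cast this
        lia
      rw [this, hz, Nat.cast_zero, sub_zero]
  have hker : LieModule.ker ℂ 𝔩 V = ⊤ := by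
    refine (eq_bot_or_eq_top (LieModule.ker ℂ 𝔩 V)).resolve_left fun h => ?_
    have hmem : ((charElt b s : H) : 𝔩) ∈ LieModule.ker ℂ 𝔩 V := by
      rw [LieModule.mem_ker]
      intro v
      have : v ∈ eig V (charElt b s) 0 := htop ▸ trivial
      rw [mem_eig.1 this, zero_smul]
    rw [h, LieSubmodule.mem_bot, ZeroMemClass.coe_eq_zero] at hmem
    have := root_charElt b s s
    rw [hmem, map_zero, Finsupp.single_eq_same] at this
    exact zero_ne_one this
  obtain ⟨v, hv, hv0, -⟩ := hϖ
  ext h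
  have : (h : 𝔩) ∈ LieModule.ker ℂ 𝔩 V := hker ▸ trivial
  rw [LieModule.mem_ker] at this
  have h2 := mem_weightSpace'.1 hv h
  rw [this v] at h2
  exact (smul_eq_zero.1 h2.symm).resolve_right hv0

lemma coe_mu (hϖ : IsHighestWeight b V ϖ) (hneg : NegOneMemWeyl H)
    (hirr : IsIrreducible ℂ 𝔩 𝔩) (hϖ0 : ϖ ≠ 0) :
    (mu V (charElt b s) : ℂ) = ϖ (charElt b s) := by
  obtain ⟨N, hN, hN'⟩ := hϖ.exists_apply_charElt_eq s hneg hirr hϖ0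
  have hgr : IsGreatest {r : ℝ | r ≠ 0 ∧
      (toEnd ℂ 𝔩 V (charElt b s : 𝔩)).HasEigenvalue (r : ℂ)} (N / 2 : ℝ) := by
    refine ⟨⟨by positivity, ?_⟩, ?_⟩
    · have := hϖ.eig_ne_bot (charElt b s)
      rw [hN'] at this
      rw [Module.End.hasEigenvalue_iff]
      push_cast
      exact this
    · rintro r ⟨-, hr⟩
      obtain ⟨n, hn⟩ := hϖ.exists_eq_sub s (c := r) (Module.End.hasEigenvalue_iff.1 hr)
      rw [hN'] at hn
      have : r = N / 2 - n := Complex.ofReal_injective (by push_cast; exact hn)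
      rw [this]
      have : (0 : ℝ) ≤ n := n.cast_nonneg
      linarith
  rw [mu, hgr.csSup_eq, hN']
  push_cast
  rfl

lemma uTilde_eq (hϖ : IsHighestWeight b V ϖ) (hneg : NegOneMemWeyl H)
    (hirr : IsIrreducible ℂ 𝔩 𝔩) (hϖ0 : ϖ ≠ 0) (i : ℤ) :
    uTilde V (charElt b s) i = eig V (charElt b s) (-ϖ (charElt b s) + 1 + i) := by
  rw [← hϖ.coe_mu s hneg hirr hϖ0, uTilde, uPart]
  push_cast
  rfl

/-- The vectors killed by the part of degree `-1` have the lowest degree. -/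
theorem lowKer_le_eig (hϖ : IsHighestWeight b V ϖ) (hneg : NegOneMemWeyl H) :
    lowKer V (charElt b s) ≤ eig V (charElt b s) (-ϖ (charElt b s)) := by
  refine (lowKer_le (iSup_lPart_charElt b s)
    (fun v hv k hk => lie_eq_zero_of_mem_lowKer b s hv hk)
    (iSup_eig_eq_top_of_iSup (hϖ.iSup_eig_sub_eq_top s))
    (eig_neg_ne_bot hneg hϖ.weightSpace_ne_bot _ (hϖ.eig_ne_bot (charElt b s)))).trans
    (iSup_le fun n => ?_)
  rcases Nat.eq_zero_or_pos n with rfl | hn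
  · simp
  · have := hϖ.eig_neg_sub_eq_bot s hneg (n := n) (by exact_mod_cast hn)
    rw [Int.cast_natCast] at this
    rw [this]
    exact bot_le

end IsHighestWeight

/-- A vector killed by the root spaces of the negatives of the simple roots is killed by the
negative part of every gradation defined by a characteristic element. -/
lemma mem_lowKer_of_forall {w : V} (hw : ∀ j : b.support,
      ∀ x ∈ rootSpace H (-(rootSystem H).root j : Module.Dual ℂ H), ⁅x, w⁆ = 0) (s : b.support) :
    w ∈ lowKer V (charElt b s) :=
  lPart_charElt_le_of_neg b s (by lia) (stabilizer w).toSubmodule fun _ hi _ =>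
    rootSpace_neg_le_of_isPos b (stabilizer w) (fun j hj x hx => hw ⟨j, hj⟩ x hx) hi

/-- The characteristic elements span the Cartan subalgebra. -/
lemma ext_charElt {M : Type*} [AddCommGroup M] [Module ℂ M] {f g : H →ₗ[ℂ] M}
    (h : ∀ j, f (charElt b j) = g (charElt b j)) : f = g := by
  classical
  refine (b.toWeightBasis.dualBasis.map (Module.evalEquiv ℂ H).symm).ext fun j => ?_
  simpa [charElt] using h j

/-- If `-1` is in the Weyl group, a lowest weight is the opposite of the highest weight. -/
theorem IsHighestWeight.lie_eq_neg_smul [IsIrreducible ℂ 𝔩 V] [FiniteDimensional ℂ V]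
    (hϖ : IsHighestWeight b V ϖ) (hneg : NegOneMemWeyl H) {w : V}
    (hw : ∀ j : b.support,
      ∀ x ∈ rootSpace H (-(rootSystem H).root j : Module.Dual ℂ H), ⁅x, w⁆ = 0) (h : H) :
    ⁅(h : 𝔩), w⁆ = -ϖ h • w := by
  have : (toEnd ℂ 𝔩 V : 𝔩 →ₗ[ℂ] Module.End ℂ V).flip w ∘ₗ H.toSubmodule.subtype = (-ϖ).smulRight w := by
    refine ext_charElt (b := b) fun j => ?_
    rw [LinearMap.smulRight_apply, LinearMap.neg_apply]
    exact mem_eig.1 (hϖ.lowKer_le_eig j hneg (mem_lowKer_of_forall hw j))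
  exact LinearMap.congr_fun this h

/-- No nonzero element of `𝔩` of nonnegative degree commutes with `𝔩₋₁`. -/
theorem disjoint_lowKer_iSup_lPart (s : b.support) (hirr : IsIrreducible ℂ 𝔩 𝔩) :
    Disjoint (lowKer 𝔩 (charElt b s)) (⨆ p : {p : ℤ // 0 ≤ p}, lPart (charElt b s) p) := by
  have htop : ⨆ k : ℤ, eig 𝔩 (charElt b s) (k : ℂ) = ⊤ := iSup_lPart_charElt b s
  have hne : eig 𝔩 (charElt b s) (-1) ≠ ⊥ := by
    obtain ⟨j, hj⟩ := exists_root_neg (s : H.root)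
    obtain ⟨x, hx, hx0⟩ := j.1.exists_ne_zero
    refine (Submodule.ne_bot_iff _).2 ⟨x, ?_, hx0⟩
    have := rootSpace_neg_le_lPart_self b s (x := x) (by rw [← hj]; exact hx)
    simpa [lPart] using this
  have h1 := lowKer_le (V := 𝔩) (iSup_lPart_charElt b s)
    (fun v hv k hk => lie_eq_zero_of_mem_lowKer b s hv hk) (iSup_eig_eq_top_of_iSup htop) hne
  have hdis := (Module.End.eigenspaces_iSupIndep
    (toEnd ℂ 𝔩 𝔩 (charElt b s : 𝔩))).disjoint_biSup_biSup
    (s := Set.range fun n : ℕ => (-1 - n : ℂ))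
    (t := Set.range fun p : {p : ℤ // 0 ≤ p} => ((p : ℤ) : ℂ)) (by
      rw [Set.disjoint_left]
      rintro _ ⟨n, rfl⟩ ⟨⟨p, hp⟩, h⟩
      have h' : (p : ℂ) = -1 - n := h
      have : p + 1 + n = 0 := by
        have : (p : ℂ) + 1 + n = 0 := by rw [h']; ring
        exact_mod_cast this
      lia)
  refine hdis.mono (h1.trans ?_) ?_
  · rw [iSup_range]
  · rw [iSup_range]
    rfl

end Spectrum

section Rank

/-! ### The rank of the bracket of the part of degree `-1` with a vector -/

variable {V : Type*} [AddCommGroup V] [Module ℂ V] [LieRingModule 𝔩 V] [LieModule ℂ 𝔩 V]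

/-- Powers of `f` pass through the action of `x` by a binomial formula. -/
lemma lie_toEnd_pow (f x : 𝔩) (u : V) (n : ℕ) :
    ⁅x, ((toEnd ℂ 𝔩 V f) ^ n) u⁆ = ∑ p ∈ Finset.HasAntidiagonal.antidiagonal n,
      n.choose p.1 • ((toEnd ℂ 𝔩 V f) ^ p.1) ⁅((-ad ℂ 𝔩 f) ^ p.2) x, u⁆ := by
  let φ : V → 𝔩 →ₗ[ℂ] V := fun v => (toEnd ℂ 𝔩 V : 𝔩 →ₗ[ℂ] Module.End ℂ V).flip v
  let A : Module.End ℂ (𝔩 →ₗ[ℂ] V) := LinearMap.llcomp ℂ 𝔩 V V (toEnd ℂ 𝔩 V f)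
  let B : Module.End ℂ (𝔩 →ₗ[ℂ] V) := LinearMap.lcomp ℂ V (-ad ℂ 𝔩 f)
  have hAB : Commute A B := by
    ext ψ y
    rfl
  have hA (m : ℕ) (ψ : 𝔩 →ₗ[ℂ] V) (y : 𝔩) : (A ^ m) ψ y = ((toEnd ℂ 𝔩 V f) ^ m) (ψ y) := by
    induction m generalizing ψ with
    | zero => rfl
    | succ m ih =>
      rw [pow_succ, Module.End.mul_apply, ih, pow_succ, Module.End.mul_apply]
      rfl
  have hB (m : ℕ) (ψ : 𝔩 →ₗ[ℂ] V) (y : 𝔩) : (B ^ m) ψ y = ψ (((-ad ℂ 𝔩 f) ^ m) y) := by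
    induction m generalizing ψ with
    | zero => rfl
    | succ m ih =>
      rw [pow_succ, Module.End.mul_apply, ih, pow_succ', Module.End.mul_apply]
      rfl
  have hstep (v : V) : φ ⁅f, v⁆ = (A + B) (φ v) := by
    ext y
    change ⁅y, ⁅f, v⁆⁆ = ⁅f, ⁅y, v⁆⁆ + ⁅-⁅f, y⁆, v⁆
    rw [neg_lie, lie_lie]
    abel
  have hpow (n : ℕ) : φ (((toEnd ℂ 𝔩 V f) ^ n) u) = ((A + B) ^ n) (φ u) := by
    induction n with
    | zero => rfl
    | succ n ih =>
      rw [pow_succ', Module.End.mul_apply, toEnd_apply_apply, hstep, ih, pow_succ',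
        Module.End.mul_apply]
  change φ (((toEnd ℂ 𝔩 V f) ^ n) u) x = _
  rw [hpow, hAB.add_pow', LinearMap.sum_apply, LinearMap.sum_apply]
  refine Finset.sum_congr rfl fun p _ => ?_
  rw [LinearMap.smul_apply, LinearMap.smul_apply, Module.End.mul_apply, hA, hB]
  rfl

/-- `[𝔩₋₁, u]` has dimension at most one. -/
def RankLeOne (E : H) (u : V) : Prop :=
  ∃ w : V, ∀ x ∈ lPart E (-1), ∃ c : ℂ, ⁅x, u⁆ = c • w

/-- If `[𝔩₋₁, u]` has dimension at most one, so does `[𝔩₋₁, fⁿ u]` for the last nonzero `fⁿ u`,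
where `f` is a nilpotent element of degree zero. This is the limit of `exp (t f) u` in projective
space for `t → ∞`, and the rank can only drop in the limit. -/
lemma RankLeOne.exists_pow {E : H} {c : ℂ} (hker : lowKer V E ⊓ eig V E c = ⊥) {u : V}
    (hu : u ∈ eig V E c) (hu0 : u ≠ 0) (hrank : RankLeOne E u) {f : 𝔩} (hf : f ∈ lPart E 0)
    (hfV : IsNilpotent (toEnd ℂ 𝔩 V f)) (hfl : IsNilpotent (ad ℂ 𝔩 f)) :
    ∃ n : ℕ, ((toEnd ℂ 𝔩 V f) ^ n) u ≠ 0 ∧ ⁅f, ((toEnd ℂ 𝔩 V f) ^ n) u⁆ = 0 ∧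
      RankLeOne E (((toEnd ℂ 𝔩 V f) ^ n) u) := by
  obtain ⟨w, hw⟩ := hrank
  have hfx (k : ℕ) {x : 𝔩} (hx : x ∈ lPart E (-1)) :
      ((-ad ℂ 𝔩 f) ^ k) x ∈ lPart E (-1) := by
    induction k with
    | zero => exact hx
    | succ k ih =>
      rw [pow_succ', Module.End.mul_apply]
      have := (lPart E (-1)).neg_mem (by simpa using lie_mem_lPart hf ih)
      simpa using this
  have hpow (n : ℕ) : ((toEnd ℂ 𝔩 V f) ^ n) u ∈ eig V E c := by
    induction n with
    | zero => exact hu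
    | succ n ih =>
      rw [pow_succ', Module.End.mul_apply]
      simpa using lie_mem_eig hf ih
  have hnker {v : V} (hv : v ∈ eig V E c) (hv0 : v ≠ 0) : ∃ x ∈ lPart E (-1), ⁅x, v⁆ ≠ 0 := by
    by_contra! h
    have : v ∈ lowKer V E ⊓ eig V E c := ⟨h, hv⟩
    rw [hker] at this
    exact hv0 this
  obtain ⟨x₀, hx₀, hxu⟩ := hnker hu hu0
  have hw0 : w ≠ 0 := by
    rintro rfl
    obtain ⟨d, hd⟩ := hw x₀ hx₀
    exact hxu (by rw [hd, smul_zero])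
  -- Let `r` be the largest exponent with `f ^ r w ≠ 0`, and `s` the largest one such that
  -- `(-ad f) ^ s` maps some element of `𝔩₋₁` to an element not killing `u`. In the binomial
  -- formula for the exponent `r + s` a single term survives, and none for `r + s + 1`.
  obtain ⟨r, hr, hr'⟩ := Nat.exists_not_and_succ_of_not_zero_of_exists
    (p := fun n => ((toEnd ℂ 𝔩 V f) ^ n) w = 0) (by simpa using hw0) (by
      obtain ⟨n, hn⟩ := hfV
      exact ⟨n, by rw [hn, LinearMap.zero_apply]⟩)
  obtain ⟨s, hs, hs'⟩ := Nat.exists_not_and_succ_of_not_zero_of_exists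
    (p := fun n => ∀ k, n ≤ k → ∀ x ∈ lPart E (-1), ⁅((-ad ℂ 𝔩 f) ^ k) x, u⁆ = 0)
    (fun h => hxu (h 0 le_rfl x₀ hx₀)) (by
      obtain ⟨n, hn⟩ := hfl.neg
      exact ⟨n, fun k hk x _ => by
        rw [pow_eq_zero_of_le hk hn, LinearMap.zero_apply, zero_lie]⟩)
  have hr'' : ∀ m, r + 1 ≤ m → ((toEnd ℂ 𝔩 V f) ^ m) w = 0 := by
    intro m hm
    obtain ⟨d, rfl⟩ := Nat.exists_eq_add_of_le' hm
    rw [pow_add, Module.End.mul_apply, hr', map_zero]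
  have hterm {m k : ℕ} (hmk : r + 1 ≤ m ∨ s + 1 ≤ k) {x : 𝔩} (hx : x ∈ lPart E (-1)) :
      ((toEnd ℂ 𝔩 V f) ^ m) ⁅((-ad ℂ 𝔩 f) ^ k) x, u⁆ = 0 := by
    rcases hmk with h | h
    · obtain ⟨d, hd⟩ := hw _ (hfx k hx)
      rw [hd, map_smul, hr'' m h, smul_zero]
    · rw [hs' k h x hx, map_zero]
  have hlead {x : 𝔩} (hx : x ∈ lPart E (-1)) : ⁅x, ((toEnd ℂ 𝔩 V f) ^ (r + s)) u⁆ =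
      (r + s).choose r • ((toEnd ℂ 𝔩 V f) ^ r) ⁅((-ad ℂ 𝔩 f) ^ s) x, u⁆ := by
    rw [lie_toEnd_pow, Finset.sum_eq_single (r, s)]
    · intro p hp hne
      rw [hterm _ hx, smul_zero]
      rw [Finset.HasAntidiagonal.mem_antidiagonal] at hp
      by_contra! h
      exact hne (Prod.ext (by lia) (by lia))
    · intro h
      exact absurd (by rw [Finset.HasAntidiagonal.mem_antidiagonal]) h
  refine ⟨r + s, fun h0 => ?_, ?_, ((toEnd ℂ 𝔩 V f) ^ r) w, fun x hx => ?_⟩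
  · refine hs fun k hk x hx => ?_
    rcases hk.eq_or_lt with rfl | hk
    · obtain ⟨d, hd⟩ := hw _ (hfx s hx)
      have h := hlead hx
      rw [h0, lie_zero, hd, map_smul, eq_comm, ← Nat.cast_smul_eq_nsmul ℂ, smul_eq_zero,
        smul_eq_zero] at h
      rcases h with h | h | h
      · exact absurd (Nat.cast_eq_zero.1 h) (Nat.choose_pos (Nat.le_add_right r s)).ne'
      · rw [hd, h, zero_smul]
      · exact absurd h hr
    · exact hs' k hk x hx
  · by_contra h
    have hmem := hpow (r + s + 1)
    rw [pow_succ', Module.End.mul_apply, toEnd_apply_apply] at hmem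
    obtain ⟨x, hx, hne⟩ := hnker hmem h
    refine hne ?_
    have := lie_toEnd_pow f x u (r + s + 1)
    rw [pow_succ', Module.End.mul_apply, toEnd_apply_apply] at this
    rw [this]
    refine Finset.sum_eq_zero fun p hp => ?_
    rw [hterm _ hx, smul_zero]
    rw [Finset.HasAntidiagonal.mem_antidiagonal] at hp
    lia
  · obtain ⟨d, hd⟩ := hw _ (hfx s hx)
    exact ⟨(r + s).choose r * d, by
      rw [hlead hx, hd, map_smul, mul_smul, Nat.cast_smul_eq_nsmul]⟩

variable {b : (rootSystem H).Base} {ϖ : Module.Dual ℂ H}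

/-- Going down along the simple roots other than `α`, a vector with `[𝔩₋₁, u]` of dimension at
most one can be replaced by one that is killed by their negative root spaces: this is a fixed
vector of a Borel subalgebra of `𝔩₀`. The process stops because it decreases the degree defined by
the sum of all characteristic elements. -/
lemma RankLeOne.exists_lowest [IsIrreducible ℂ 𝔩 V] [FiniteDimensional ℂ V]
    (hϖ : IsHighestWeight b V ϖ) (hneg : NegOneMemWeyl H) (s : b.support) {c : ℂ}
    (hker : lowKer V (charElt b s) ⊓ eig V (charElt b s) c = ⊥) {u : V}
    (hu : u ∈ eig V (charElt b s) c) (hu0 : u ≠ 0) (hrank : RankLeOne (charElt b s) u) :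
    ∃ u ∈ eig V (charElt b s) c, u ≠ 0 ∧ RankLeOne (charElt b s) u ∧ ∀ j : b.support, j ≠ s →
      ∀ x ∈ rootSpace H (-(rootSystem H).root j : Module.Dual ℂ H), ⁅x, u⁆ = 0 := by
  classical
  set D : H := ∑ j : b.support, charElt b j
  have htop : ⨆ n : ℕ, eig V D (-ϖ D + n) = ⊤ := by
    rw [eq_top_iff, ← iSup_weightSpace_eq_top hϖ.weightSpace_ne_bot]
    refine iSup_le fun ψ => ?_
    by_cases hψ : weightSpace V ψ = ⊥
    · rw [hψ]; exact bot_le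
    obtain ⟨v, hv, hv0⟩ := weightSpace_ne_bot_iff.1 hψ
    have : ∀ j : b.support, ∃ n : ℕ, ψ (charElt b j) = -ϖ (charElt b j) + n := fun j =>
      hϖ.exists_eq_neg_add j hneg
        ((Submodule.ne_bot_iff _).2 ⟨v, weightSpace_le_eig ψ _ hv, hv0⟩)
    choose n hn using this
    refine le_iSup_of_le (∑ j, n j) ?_
    have : ψ D = -ϖ D + (∑ j, n j : ℕ) := by
      simp only [D, map_sum, hn, Finset.sum_add_distrib, Finset.sum_neg_distrib, Nat.cast_sum]
    rw [← this]
    exact weightSpace_le_eig ψ D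
  have hD : ∀ j : b.support,
      ∀ x ∈ rootSpace H (-(rootSystem H).root j : Module.Dual ℂ H), x ∈ lPart D (-1) := by
    intro j x hx
    refine rootSpace_le_lPart ?_ hx
    rw [LinearMap.neg_apply, map_sum, Finset.sum_congr rfl fun i _ => root_charElt b i j]
    simp [Finsupp.single_apply]
  -- The filtration of `V` by the degree with respect to `D`.
  let F : ℕ → Submodule ℂ V := fun n => ⨆ k : Fin n, eig V D (-ϖ D + (k : ℕ))
  have hFmono : Monotone F := fun m n hmn => iSup_le fun k =>
    le_iSup (fun k : Fin n => eig V D (-ϖ D + (k : ℕ))) (Fin.castLE hmn k)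
  have hFlie : ∀ j : b.support, ∀ x ∈ rootSpace H (-(rootSystem H).root j : Module.Dual ℂ H),
      ∀ n, ∀ v ∈ F (n + 1), ⁅x, v⁆ ∈ F n := by
    intro j x hx n v hv
    induction hv using Submodule.iSup_induction' with
    | mem k v hv =>
      have h := lie_mem_eig (hD j x hx) hv
      obtain ⟨k, hk⟩ := k
      rcases k with _ | k
      · have : eig V D (-ϖ D + (0 : ℕ) + (-1 : ℤ)) = ⊥ := by
          by_contra hne
          obtain ⟨n, hn⟩ := exists_eq_of_eig_ne_bot htop hne
          have : ((n + 1 : ℕ) : ℂ) = 0 := by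
            push_cast at hn ⊢
            linear_combination -hn
          exact n.succ_ne_zero (by exact_mod_cast this)
        rw [this, Submodule.mem_bot] at h
        rw [h]
        exact zero_mem _
      · refine Submodule.mem_iSup_of_mem (⟨k, by lia⟩ : Fin n) ?_
        convert h using 2
        push_cast
        ring
    | zero => simp
    | add v w _ _ hv hw => rw [lie_add]; exact add_mem hv hw
  have hFpow : ∀ j : b.support, ∀ x ∈ rootSpace H (-(rootSystem H).root j : Module.Dual ℂ H),
      ∀ m n, ∀ v ∈ F n, ((toEnd ℂ 𝔩 V x) ^ m) v ∈ F (n - m) := by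
    intro j x hx m n v hv
    induction m with
    | zero => exact hv
    | succ m ih =>
      rw [pow_succ', Module.End.mul_apply, toEnd_apply_apply]
      exact hFlie j x hx _ _ (hFmono (by lia) ih)
  obtain ⟨n, hn⟩ : ∃ n, u ∈ F n := by
    have hu' : u ∈ ⨆ n : ℕ, eig V D (-ϖ D + n) := htop ▸ trivial
    clear hu hu0 hrank
    induction hu' using Submodule.iSup_induction' with
    | mem k v hv => exact ⟨k + 1, Submodule.mem_iSup_of_mem (Fin.last k) (by simpa using hv)⟩
    | zero => exact ⟨0, zero_mem _⟩
    | add v w _ _ hv hw =>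
      obtain ⟨m, hm⟩ := hv
      obtain ⟨n, hn⟩ := hw
      exact ⟨max m n, add_mem (hFmono (le_max_left m n) hm) (hFmono (le_max_right m n) hn)⟩
  induction n using Nat.strong_induction_on generalizing u with
  | _ n ih =>
    by_cases h : ∀ j : b.support, j ≠ s →
      ∀ x ∈ rootSpace H (-(rootSystem H).root j : Module.Dual ℂ H), ⁅x, u⁆ = 0
    · exact ⟨u, hu, hu0, hrank, h⟩
    · push Not at h
      obtain ⟨j, hjs, x, hx, hxu⟩ := h
      have hx0 : (-(rootSystem H).root j : Module.Dual ℂ H) ≠ 0 :=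
        neg_ne_zero.2 ((rootSystem H).ne_zero j)
      have hx0' : (⇑(-(rootSystem H).root j : Module.Dual ℂ H) : H → ℂ) ≠ 0 := fun h0 =>
        hx0 (by ext y; exact congrFun h0 y)
      obtain ⟨k, hk0, hk, hkr⟩ := hrank.exists_pow hker hu hu0
        (rootSpace_neg_le_lPart_of_ne b hjs hx)
        (isNilpotent_toEnd_of_mem_rootSpace V H hx0' hx)
        (isNilpotent_toEnd_of_mem_rootSpace 𝔩 H hx0' hx)
      have hkpos : 0 < k := Nat.pos_of_ne_zero fun h0 => hxu (by simpa [h0] using hk)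
      have hn0 : 0 < n := Nat.pos_of_ne_zero fun h0 => hu0 (by
        subst h0
        have : F 0 = ⊥ := iSup_of_empty _
        rwa [this, Submodule.mem_bot] at hn)
      refine ih (n - k) (by lia) ?_ hk0 hkr (hFpow j x hx k n u hn)
      have (m : ℕ) : ((toEnd ℂ 𝔩 V x) ^ m) u ∈ eig V (charElt b s) c := by
        induction m with
        | zero => exact hu
        | succ m ih =>
          rw [pow_succ', Module.End.mul_apply]
          simpa using lie_mem_eig (rootSpace_neg_le_lPart_of_ne b hjs hx) ih
      exact this k

/-- If the highest weight vanishes at the coroot of `α`, then `[𝔩₋₁, u]` has dimension at least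
two for every nonzero vector `u` of lowest degree but one. Otherwise there would be such a `u`
that, under the subalgebra `𝔰𝔩₂` of `α`, would have weight `2` and be the top of an infinite
string. -/
theorem not_rankLeOne [IsIrreducible ℂ 𝔩 V] [FiniteDimensional ℂ V]
    (hϖ : IsHighestWeight b V ϖ) (hneg : NegOneMemWeyl H) (s : b.support)
    (hs : ϖ ((rootSystem H).coroot s) = 0) {u : V}
    (hu : u ∈ eig V (charElt b s) (-ϖ (charElt b s) + 1)) (hu0 : u ≠ 0) :
    ¬ RankLeOne (charElt b s) u := by
  intro hrank
  set a : ℂ := ϖ (charElt b s)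
  have hdis : ∀ v ∈ eig V (charElt b s) (-a), v ∈ eig V (charElt b s) (-a + 1) → v = 0 := by
    intro v h1 h2
    have := (mem_eig.1 h1).symm.trans (mem_eig.1 h2)
    rw [add_smul, one_smul, left_eq_add] at this
    exact this
  obtain ⟨u, hu, hu0, ⟨w', hw'⟩, hlow⟩ := hrank.exists_lowest hϖ hneg s (by
    rw [eq_bot_iff]
    rintro v ⟨h1, h2⟩
    exact hdis v (hϖ.lowKer_le_eig s hneg h1) h2) hu hu0
  have hα : ((s : H.root) : Weight ℂ H 𝔩).IsNonZero := H.isNonZero_coe_root (s : H.root)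
  obtain ⟨h, e, f, t, he, hf⟩ := exists_isSl2Triple_of_weight_isNonZero hα
  obtain rfl := t.h_eq_coroot hα he hf
  set h : H := (rootSystem H).coroot s
  replace hf : f ∈ rootSpace H (-(rootSystem H).root s : Module.Dual ℂ H) := hf
  have hcoroot : coroot ((s : H.root) : Weight ℂ H 𝔩) = h := rfl
  rw [hcoroot] at t
  have hall : ∀ v ∈ eig V (charElt b s) (-a + 1), (∀ j : b.support,
      ∀ x ∈ rootSpace H (-(rootSystem H).root j : Module.Dual ℂ H), ⁅x, v⁆ = 0) → v = 0 := by
    intro v hv hv'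
    exact hdis v (hϖ.lowKer_le_eig s hneg (mem_lowKer_of_forall hv' s)) hv
  have hspan : ∀ x ∈ rootSpace H (-(rootSystem H).root s : Module.Dual ℂ H),
      ∃ c : ℂ, c • f = x := by
    intro x hx
    have h1 := finrank_rootSpace_eq_one (-((s : H.root) : Weight ℂ H 𝔩)) hα.neg
    rw [Weight.coe_neg] at h1
    obtain ⟨c, hc⟩ := (finrank_eq_one_iff_of_nonzero'
      (⟨f, hf⟩ : rootSpace H (-(rootSystem H).root s : Module.Dual ℂ H))
      (fun h0 => t.f_ne_zero (congrArg Subtype.val h0))).1 h1 ⟨x, hx⟩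
    exact ⟨c, congrArg Subtype.val hc⟩
  have hf1 : f ∈ lPart (charElt b s) (-1) := rootSpace_neg_le_lPart_self b s hf
  set w : V := ⁅f, u⁆ with hwdef
  have hw0 : w ≠ 0 := by
    intro h0
    refine hu0 (hall u hu fun j x hx => ?_)
    rcases eq_or_ne j s with rfl | hj
    · obtain ⟨c, rfl⟩ := hspan x hx
      rw [smul_lie, ← hwdef, h0, smul_zero]
    · exact hlow j hj x hx
  have hw : ∀ x ∈ lPart (charElt b s) (-1), ∃ c : ℂ, ⁅x, u⁆ = c • w := by
    intro x hx
    obtain ⟨d, hd⟩ := hw' f hf1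
    obtain ⟨c, hc⟩ := hw' x hx
    have hd0 : d ≠ 0 := by
      rintro rfl
      exact hw0 (by rw [hwdef, hd, zero_smul])
    exact ⟨c / d, by rw [hc, hwdef, hd, smul_smul, div_mul_cancel₀ _ hd0]⟩
  have hwlow : ∀ j : b.support,
      ∀ x ∈ rootSpace H (-(rootSystem H).root j : Module.Dual ℂ H), ⁅x, w⁆ = 0 := by
    intro j x hx
    rcases eq_or_ne j s with rfl | hj
    · have h1 := lie_mem_eig (rootSpace_neg_le_lPart_self b j hx) (lie_mem_eig hf1 hu)
      have h2 := hϖ.eig_neg_sub_eq_bot j hneg (n := 1) one_pos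
      have h3 : -a + 1 + (-1 : ℤ) + (-1 : ℤ) = -ϖ (charElt b j) - (1 : ℤ) := by
        push_cast
        ring
      rw [h3, h2, Submodule.mem_bot] at h1
      exact h1
    · have hx0 := rootSpace_neg_le_lPart_of_ne b hj hx
      obtain ⟨c, hc⟩ := hw ⁅x, f⁆ (by simpa using lie_mem_lPart hx0 hf1)
      have hxw : ⁅x, w⁆ = c • w := by
        rw [hwdef, leibniz_lie, hc, hlow j hj x hx, lie_zero, add_zero]
      have hx0' : (⇑(-(rootSystem H).root j : Module.Dual ℂ H) : H → ℂ) ≠ 0 := fun h0 =>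
        neg_ne_zero.2 ((rootSystem H).ne_zero j) (by ext y; exact congrFun h0 y)
      obtain ⟨n, hn⟩ := isNilpotent_toEnd_of_mem_rootSpace V H hx0' hx
      have hpow (n : ℕ) : ((toEnd ℂ 𝔩 V x) ^ n) w = c ^ n • w := by
        induction n with
        | zero => simp
        | succ n ih =>
          rw [pow_succ', Module.End.mul_apply, ih, map_smul, toEnd_apply_apply, hxw, smul_smul,
            pow_succ]
      have h1 := hpow n
      rw [hn, LinearMap.zero_apply, eq_comm, smul_eq_zero] at h1
      rw [hxw, eq_zero_of_pow_eq_zero (h1.resolve_right hw0), zero_smul]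
  have hhw : ⁅(h : 𝔩), w⁆ = 0 := by
    rw [hϖ.lie_eq_neg_smul hneg hwlow, hs, neg_zero, zero_smul]
  have hfw : ⁅f, w⁆ = 0 := hwlow s f hf
  -- `u` has weight `2` because `⁅h, u⁆ - 2 • u` is killed by all the lowering operators.
  have hhu : ⁅(h : 𝔩), u⁆ = (2 : ℂ) • u := by
    rw [← sub_eq_zero]
    refine hall _ (sub_mem ?_ (Submodule.smul_mem _ _ hu)) fun j x hx => ?_
    · have hh : (h : 𝔩) ∈ lPart (charElt b s) 0 := by
        rw [mem_lPart, Int.cast_zero, zero_smul]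
        exact congrArg Subtype.val (trivial_lie_zero H H (charElt b s) h)
      simpa using lie_mem_eig hh hu
    · have hhx : ⁅(h : 𝔩), x⁆ = (-(rootSystem H).root j : Module.Dual ℂ H) h • x :=
        lie_eq_smul_of_mem_rootSpace hx h
      have hxh : ⁅x, ⁅(h : 𝔩), u⁆⁆ =
          ⁅(h : 𝔩), ⁅x, u⁆⁆ - (-(rootSystem H).root j : Module.Dual ℂ H) h • ⁅x, u⁆ := by
        rw [leibniz_lie (h : 𝔩) x u, hhx, smul_lie]
        abel
      rw [lie_sub, lie_smul, hxh]
      rcases eq_or_ne j s with rfl | hj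
      · have h2 : (-(rootSystem H).root j : Module.Dual ℂ H) h = -2 := by
          rw [LinearMap.neg_apply]
          congr 1
          exact (rootSystem H).root_coroot_two j
        obtain ⟨c, hc⟩ := hw x (rootSpace_neg_le_lPart_self b j hx)
        rw [h2, hc, lie_smul, hhw]
        simp
      · rw [hlow j hj x hx]
        simp
  -- `w` is a lowest weight vector of weight `0` for `𝔰𝔩₂`, hence invariant.
  have hew : ⁅e, w⁆ = 0 := by
    have prim : t.symm.HasPrimitiveVectorWith w (0 : ℂ) :=
      { ne_zero := hw0
        lie_h := by rw [neg_lie, hhw, neg_zero, zero_smul]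
        lie_e := hfw }
    have := prim.pow_toEnd_f_eq_zero_of_eq_nat (n := 0) (by simp)
    simpa using this
  have hhe (n : ℕ) : ⁅(h : 𝔩), ((toEnd ℂ 𝔩 V e) ^ n) u⁆ =
      (2 + 2 * n : ℂ) • ((toEnd ℂ 𝔩 V e) ^ n) u := by
    induction n with
    | zero => simpa using hhu
    | succ n ih =>
      rw [pow_succ', Module.End.mul_apply, toEnd_apply_apply, leibniz_lie, ih, t.lie_h_e_nsmul,
        lie_smul, ← Nat.cast_smul_eq_nsmul ℂ, smul_lie, ← add_smul]
      congr 1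
      push_cast
      ring
  have hfe (n : ℕ) : ⁅f, ((toEnd ℂ 𝔩 V e) ^ (n + 1)) u⁆ =
      (-((n + 1) * (n + 2)) : ℂ) • ((toEnd ℂ 𝔩 V e) ^ n) u := by
    have hstep (n : ℕ) : ⁅f, ((toEnd ℂ 𝔩 V e) ^ (n + 1)) u⁆ =
        ⁅e, ⁅f, ((toEnd ℂ 𝔩 V e) ^ n) u⁆⁆ - (2 + 2 * n : ℂ) • ((toEnd ℂ 𝔩 V e) ^ n) u := by
      rw [← hhe, pow_succ', Module.End.mul_apply, toEnd_apply_apply, ← t.lie_e_f, lie_lie]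
      abel
    induction n with
    | zero =>
      rw [hstep, pow_zero, Module.End.one_apply, ← hwdef, hew, zero_sub, ← neg_smul]
      congr 1
      push_cast
      ring
    | succ n ih =>
      have h1 : ((toEnd ℂ 𝔩 V e) ^ (n + 1)) u = ⁅e, ((toEnd ℂ 𝔩 V e) ^ n) u⁆ := by
        rw [pow_succ', Module.End.mul_apply, toEnd_apply_apply]
      rw [hstep, ih, lie_smul, ← h1, ← sub_smul]
      congr 1
      push_cast
      ring
  have hne (n : ℕ) : ((toEnd ℂ 𝔩 V e) ^ n) u ≠ 0 := by
    induction n with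
    | zero => simpa using hu0
    | succ n ih =>
      intro h0
      have h1 := hfe n
      rw [h0, lie_zero, eq_comm, smul_eq_zero] at h1
      refine h1.elim (fun h2 => ?_) ih
      have : (((n + 1) * (n + 2) : ℕ) : ℂ) = 0 := by
        push_cast
        linear_combination -h2
      exact (by positivity : (n + 1) * (n + 2) ≠ 0) (by exact_mod_cast this)
  obtain ⟨n, hn⟩ := isNilpotent_toEnd_of_mem_rootSpace V H
    (χ := ((s : H.root) : Weight ℂ H 𝔩)) (fun h0 => hα h0) he
  exact hne n (by rw [hn, LinearMap.zero_apply])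

end Rank

section Grading

/-! ### Gradations of finite-dimensional Lie algebras -/

section Gradation

variable {𝔤 : Type*} [LieRing 𝔤] [LieAlgebra ℂ 𝔤]

lemma lie_mem_iSup {g : ℤ → Submodule ℂ 𝔤}
    (hg : ∀ p q : ℤ, ∀ x ∈ g p, ∀ y ∈ g q, ⁅x, y⁆ ∈ g (p + q)) {m n : ℤ} {x y : 𝔤}
    (hx : x ∈ ⨆ p : {p : ℤ // p < m}, g p) (hy : y ∈ ⨆ p : {p : ℤ // p < n}, g p) :
    ⁅x, y⁆ ∈ ⨆ p : {p : ℤ // p < m + n - 1}, g p := by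
  induction hx using Submodule.iSup_induction' with
  | mem p x hx =>
    induction hy using Submodule.iSup_induction' with
    | mem q y hy =>
      exact Submodule.mem_iSup_of_mem (⟨p + q, by have := p.2; have := q.2; lia⟩ :
        {p : ℤ // p < m + n - 1}) (hg p q x hx y hy)
    | zero => simp
    | add y z _ _ hy hz => rw [lie_add]; exact add_mem hy hz
  | zero => simp
  | add y z _ _ hy hz => rw [add_lie]; exact add_mem hy hz

/-- The negative part of a gradation of a finite-dimensional Lie algebra is nilpotent. -/
theorem IsGradation.exists_isNilpotent [FiniteDimensional ℂ 𝔤] {g : ℤ → Submodule ℂ 𝔤}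
    (hg : IsGradation g) : ∃ 𝔪 : LieSubalgebra ℂ 𝔤,
      𝔪.toSubmodule = ⨆ p : {p : ℤ // p < 0}, g p ∧ LieRing.IsNilpotent 𝔪 := by
  let 𝔪 : LieSubalgebra ℂ 𝔤 :=
    { (⨆ p : {p : ℤ // p < 0}, g p) with
      lie_mem' := by
        intro x y hx hy
        exact (iSup_le fun p => le_iSup_of_le (⟨p, by have := p.2; lia⟩ : {p : ℤ // p < 0}) le_rfl :
          (⨆ p : {p : ℤ // p < 0 + 0 - 1}, g p) ≤ _) (lie_mem_iSup hg.2 hx hy) }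
  obtain ⟨N, hN⟩ : ∃ N : ℕ, (⨆ p : {p : ℤ // p < -N}, g p) = ⊥ := by
    obtain ⟨B, hB⟩ := (WellFoundedGT.finite_ne_bot_of_iSupIndep hg.1.submodule_iSupIndep).bddBelow
    refine ⟨B.natAbs, eq_bot_iff.2 (iSup_le fun p => ?_)⟩
    by_contra h
    have := hB (show g p ≠ ⊥ from fun h0 => h h0.le)
    have := p.2
    lia
  refine ⟨𝔪, rfl, (LieAlgebra.isNilpotent_iff_forall (R := ℂ)).2 fun x => ⟨N, ?_⟩⟩
  ext y
  have key (n : ℕ) : ((((ad ℂ 𝔪 x) ^ n) y : 𝔪) : 𝔤) ∈ ⨆ p : {p : ℤ // p < -n}, g p := by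
    induction n with
    | zero => simp
    | succ n ih =>
      rw [pow_succ', Module.End.mul_apply]
      have := lie_mem_iSup hg.2 (x := (x : 𝔤)) x.2 ih
      rw [zero_add] at this
      rw [Nat.cast_succ, neg_add, ← sub_eq_add_neg]
      exact this
  have := key N
  rw [hN, Submodule.mem_bot] at this
  exact this

end Gradation

/-! ### The gradation of `(𝔩 + ℂ) ▷ U` -/

variable {U : Type*} [AddCommGroup U] [Module ℂ U] [LieRingModule 𝔩 U] [LieModule ℂ 𝔩 U]

instance [FiniteDimensional ℂ U] : FiniteDimensional ℂ (Aut 𝔩 U) :=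
  let f : Aut 𝔩 U →ₗ[ℂ] 𝔩 × ℂ × U :=
    { toFun := fun y => (y.l, y.c, y.u)
      map_add' := fun _ _ => rfl
      map_smul' := fun _ _ => rfl }
  Module.Finite.of_injective f (Aut.equivProd 𝔩 U).injective

lemma eq_inL_add (y : Aut 𝔩 U) : y = inL 𝔩 U y.l + inC 𝔩 U y.c + inU 𝔩 U y.u := by
  ext <;> simp [inL, inC, inU]

lemma mem_uTilde {E : H} {i : ℤ} {u : U} :
    u ∈ uTilde U E i ↔ ⁅(E : 𝔩), u⁆ = ((-mu U E + 1 + i : ℝ) : ℂ) • u :=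
  mem_eig

lemma iSupIndep_uTilde (E : H) : iSupIndep (uTilde U E) :=
  (Module.End.eigenspaces_iSupIndep (toEnd ℂ 𝔩 U (E : 𝔩))).comp
    (f := fun i : ℤ => ((-mu U E + 1 + i : ℝ) : ℂ)) fun i j h => by
      have := Complex.ofReal_injective h
      exact_mod_cast add_left_cancel this

lemma mem_gPart {E : H} (hbot : ∀ i < -1, uTilde U E i = ⊥) {p : ℤ} {y : Aut 𝔩 U} :
    y ∈ gPart U E p ↔ y.l ∈ lPart E p ∧ (p ≠ 0 → y.c = 0) ∧ y.u ∈ uTilde U E p := by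
  have hl : ∀ x ∈ lPart E p, ∀ u ∈ uTilde U E p, (inL 𝔩 U x + inU 𝔩 U u) ∈
      (lPart E p).map (inL 𝔩 U) ⊔ (uTilde U E p).map (inU 𝔩 U) := fun x hx u hu =>
    Submodule.add_mem_sup (Submodule.mem_map_of_mem hx) (Submodule.mem_map_of_mem hu)
  unfold gPart
  split_ifs with h h0
  · rw [hbot p h]
    constructor
    · rintro ⟨x, hx, rfl⟩
      exact ⟨hx, fun _ => rfl, zero_mem _⟩
    · rintro ⟨hx, hc, hu⟩
      rw [Submodule.mem_bot] at hu
      exact ⟨y.l, hx, Aut.ext rfl (hc (by lia)).symm hu.symm⟩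
  · subst h0
    constructor
    · intro hy
      obtain ⟨y', hy', _, ⟨u, hu, rfl⟩, rfl⟩ := Submodule.mem_sup.1 hy
      obtain ⟨_, ⟨x, hx, rfl⟩, _, ⟨c, rfl⟩, rfl⟩ := Submodule.mem_sup.1 hy'
      exact ⟨by simpa [inL, inC, inU] using hx, fun h => absurd rfl h,
        by simpa [inL, inC, inU] using hu⟩
    · rintro ⟨hx, -, hu⟩
      rw [eq_inL_add y]
      exact Submodule.add_mem_sup (Submodule.add_mem_sup (Submodule.mem_map_of_mem hx)
        ⟨y.c, rfl⟩) (Submodule.mem_map_of_mem hu)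
  · constructor
    · intro hy
      obtain ⟨_, ⟨x, hx, rfl⟩, _, ⟨u, hu, rfl⟩, rfl⟩ := Submodule.mem_sup.1 hy
      exact ⟨by simpa [inL, inU] using hx, fun _ => by simp [inL, inU],
        by simpa [inL, inU] using hu⟩
    · rintro ⟨hx, hc, hu⟩
      rw [eq_inL_add y, hc h0, map_zero, add_zero]
      exact Submodule.add_mem_sup (Submodule.mem_map_of_mem hx) (Submodule.mem_map_of_mem hu)

variable (U) in
/-- The grading element: `𝔤ₚ` is the eigenspace of its adjoint action with eigenvalue `p`. -/
def gradingElt (E : H) : Aut 𝔩 U := ⟨E, mu U E - 1, 0⟩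

lemma gPart_eq_eigenspace {E : H} (hbot : ∀ i < -1, uTilde U E i = ⊥) (p : ℤ) :
    gPart U E p = (ad ℂ (Aut 𝔩 U) (gradingElt U E)).eigenspace (p : ℂ) := by
  ext y
  rw [mem_gPart hbot, mem_lPart, mem_uTilde, Module.End.mem_eigenspace_iff, ad_apply, Aut.ext_iff,
    lie_l, lie_c, lie_u, smul_l, smul_c, smul_u]
  refine and_congr Iff.rfl (and_congr ?_ ?_)
  · rw [eq_comm (a := (0 : ℂ)), mul_eq_zero, Int.cast_eq_zero]
    tauto
  · simp only [gradingElt, lie_zero, sub_zero, smul_zero]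
    rw [← eq_sub_iff_add_eq, ← sub_smul]
    push_cast
    rw [show -(mu U E : ℂ) + 1 + p = p - (mu U E - 1) by ring]

lemma lie_mem_gPart {E : H} (hbot : ∀ i < -1, uTilde U E i = ⊥) (p q : ℤ) (x : Aut 𝔩 U)
    (hx : x ∈ gPart U E p) (y : Aut 𝔩 U) (hy : y ∈ gPart U E q) : ⁅x, y⁆ ∈ gPart U E (p + q) := by
  rw [gPart_eq_eigenspace hbot, Module.End.mem_eigenspace_iff, ad_apply] at *
  rw [leibniz_lie, hx, hy, smul_lie, lie_smul, ← add_smul, Int.cast_add]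

theorem isGradation_gPart {E : H} (hE : ⨆ k : ℤ, lPart E k = ⊤)
    (hbot : ∀ i < -1, uTilde U E i = ⊥) (hU : ⨆ i : ℤ, uTilde U E i = ⊤) :
    IsGradation (gPart U E) := by
  refine ⟨DirectSum.isInternal_submodule_of_iSupIndep_of_iSup_eq_top ?_ ?_,
    lie_mem_gPart hbot⟩
  · have h : gPart U E = fun p : ℤ => (ad ℂ (Aut 𝔩 U) (gradingElt U E)).eigenspace (p : ℂ) :=
      funext (gPart_eq_eigenspace hbot)
    rw [h]
    exact (Module.End.eigenspaces_iSupIndep _).comp Int.cast_injective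
  · rw [eq_top_iff]
    intro y _
    rw [eq_inL_add y]
    refine add_mem (add_mem ?_ ?_) ?_
    · have h : (⨆ k : ℤ, lPart E k).map (inL 𝔩 U) ≤ ⨆ p, gPart U E p := by
        rw [Submodule.map_iSup]
        refine iSup_mono fun k => ?_
        rintro _ ⟨x, hx, rfl⟩
        exact (mem_gPart hbot).2 ⟨hx, fun _ => rfl, zero_mem _⟩
      exact h (Submodule.mem_map_of_mem (hE ▸ trivial))
    · exact Submodule.mem_iSup_of_mem 0
        ((mem_gPart hbot).2 ⟨zero_mem _, fun h => absurd rfl h, zero_mem _⟩)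
    · have h : (⨆ k : ℤ, uTilde U E k).map (inU 𝔩 U) ≤ ⨆ p, gPart U E p := by
        rw [Submodule.map_iSup]
        refine iSup_mono fun k => ?_
        rintro _ ⟨x, hx, rfl⟩
        exact (mem_gPart hbot).2 ⟨zero_mem _, fun _ => rfl, hx⟩
      exact h (Submodule.mem_map_of_mem (hU ▸ trivial))

lemma gPart_eq_bracketSpan {E : H} (hbot : ∀ i < -1, uTilde U E i = ⊥) {p : ℤ} (hp : p < -1)
    (hl : lPart E p ≤ bracketSpan (lPart E (p + 1)) (lPart E (-1))) :
    gPart U E p = bracketSpan (gPart U E (p + 1)) (gPart U E (-1)) := by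
  have hin {k : ℤ} {x : 𝔩} (hx : x ∈ lPart E k) : inL 𝔩 U x ∈ gPart U E k :=
    (mem_gPart hbot).2 ⟨hx, fun _ => rfl, zero_mem _⟩
  refine le_antisymm ?_ (Submodule.span_le.2 ?_)
  · have hmap : gPart U E p = (lPart E p).map (inL 𝔩 U) := if_pos hp
    rw [hmap, Submodule.map_le_iff_le_comap]
    refine hl.trans (Submodule.span_le.2 ?_)
    rintro _ ⟨x, hx, y, hy, rfl⟩
    exact Submodule.subset_span ⟨_, hin hx, _, hin hy, by ext <;> simp [inL]⟩
  · rintro _ ⟨x, hx, y, hy, rfl⟩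
    have := lie_mem_gPart hbot _ _ x hx y hy
    rwa [add_neg_cancel_right] at this

section Transitivity

variable {E : H}
  (hdisl : Disjoint (lowKer 𝔩 E) (⨆ p : {p : ℤ // 0 ≤ p}, lPart E p))
  (hlow : lowKer U E ≤ uTilde U E (-1))
include hdisl hlow

lemma eq_zero_of_lie_inL_eq_zero {z : Aut 𝔩 U} (hl : z.l ∈ ⨆ p : {p : ℤ // 0 ≤ p}, lPart E p)
    (hu : z.u ∈ ⨆ i : {i : ℤ // 0 ≤ i}, uTilde U E i)
    (hz : ∀ x ∈ lPart E (-1), ⁅z, inL 𝔩 U x⁆ = 0) : z.l = 0 ∧ z.u = 0 := by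
  constructor
  · refine Submodule.disjoint_def.1 hdisl _ (fun x hx => ?_) hl
    have := congrArg Aut.l (hz x hx)
    rw [lie_l, zero_l, ← lie_skew, neg_eq_zero] at this
    exact this
  · have hdis := (iSupIndep_uTilde (U := U) E).disjoint_biSup (x := -1)
      (y := Set.range fun i : {i : ℤ // 0 ≤ i} => (i : ℤ)) (by
        rintro ⟨⟨i, hi⟩, rfl : i = -1⟩
        lia)
    rw [iSup_range] at hdis
    refine Submodule.disjoint_def.1 hdis _ (hlow fun x hx => ?_) hu
    have := congrArg Aut.u (hz x hx)
    rw [lie_u, zero_u] at this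
    simpa [inL] using this

theorem eq_zero_of_mem_luNonneg {z : Aut 𝔩 U} (hz : z ∈ luNonneg U E)
    (h : ∀ x ∈ lPart E (-1), ⁅z, inL 𝔩 U x⁆ = 0) : z = 0 := by
  obtain ⟨_, ⟨x, hx, rfl⟩, _, ⟨u, hu, rfl⟩, rfl⟩ := Submodule.mem_sup.1 hz
  obtain ⟨h1, h2⟩ := eq_zero_of_lie_inL_eq_zero hdisl hlow (by simpa [inL, inU] using hx)
    (by simpa [inL, inU] using hu) h
  exact Aut.ext h1 (by simp [inL, inU]) h2

theorem eq_zero_of_mem_gNonneg (hbot : ∀ i < -1, uTilde U E i = ⊥)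
    (hne : uTilde U E (-1) ≠ ⊥) {z : Aut 𝔩 U} (hz : z ∈ gNonneg U E)
    (h : ∀ x ∈ gPart U E (-1), ⁅z, x⁆ = 0) : z = 0 := by
  have hmem : z.l ∈ (⨆ p : {p : ℤ // 0 ≤ p}, lPart E p) ∧
      z.u ∈ ⨆ i : {i : ℤ // 0 ≤ i}, uTilde U E i := by
    clear h
    induction hz using Submodule.iSup_induction' with
    | mem p z hz =>
      obtain ⟨h1, -, h2⟩ := (mem_gPart hbot).1 hz
      exact ⟨Submodule.mem_iSup_of_mem p h1, Submodule.mem_iSup_of_mem p h2⟩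
    | zero => exact ⟨zero_mem _, zero_mem _⟩
    | add y z _ _ hy hz => exact ⟨add_mem hy.1 hz.1, add_mem hy.2 hz.2⟩
  obtain ⟨h1, h2⟩ := eq_zero_of_lie_inL_eq_zero hdisl hlow hmem.1 hmem.2 fun x hx =>
    h _ ((mem_gPart hbot).2 ⟨hx, fun _ => rfl, zero_mem _⟩)
  refine Aut.ext h1 ?_ h2
  obtain ⟨u, hu, hu0⟩ := (Submodule.ne_bot_iff _).1 hne
  have := congrArg Aut.u (h (inU 𝔩 U u) ((mem_gPart hbot).2 ⟨zero_mem _, fun _ => rfl, hu⟩))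
  rw [lie_u, zero_u, h1, h2] at this
  simpa [inU, hu0] using this

end Transitivity

end Grading

section Orthogonal

/-! ### Cartan matrices -/

section CartanMatrix

variable {m : ℕ} (A : Matrix (Fin m) (Fin m) ℤ)

/-- The Dynkin diagram contains the edges joining consecutive nodes. -/
def IsPath : Prop := ∀ i j : Fin m, (i : ℕ) + 1 = j → A i j ≠ 0 ∧ A j i ≠ 0

/-- `IsReachable A S a`: there is a root `r` with `⟨r, αⱼ^∨⟩ = a j` which is obtained from a simple
root in `S` by simple reflections in `S`. -/
inductive IsReachable (S : Set (Fin m)) : (Fin m → ℤ) → Prop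
  | simple (t : Fin m) (ht : t ∈ S) : IsReachable S (A t)
  | reflect (i : Fin m) (hi : i ∈ S) {a : Fin m → ℤ} (ha : IsReachable S a) :
      IsReachable S fun j => a j - a i * A i j

/-- There are pairwise orthogonal roots, one for each node, found as follows: for some ordering of
the nodes, the root of a node is reachable from the later nodes (including itself), and orthogonal
to the simple roots of the strictly later nodes. -/
def HasOrthogonalRoots : Prop :=
  ∃ ρ : Fin m → ℕ, Function.Injective ρ ∧ ∀ k, ∃ a, IsReachable A {t | ρ k ≤ ρ t} a ∧
    ∀ j, ρ k < ρ j → a j = 0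

variable {A}

lemma IsReachable.mono {S T : Set (Fin m)} (hST : S ⊆ T) {a : Fin m → ℤ}
    (h : IsReachable A S a) : IsReachable A T a := by
  induction h with
  | simple t ht => exact .simple t (hST ht)
  | reflect i hi _ ih => exact .reflect i (hST hi) ih

/-- In types `B` and `C` the root of the node `k` is `sₖ ⋯ s_{m-2} α_{m-1}`, which is `eₖ` or
`2 eₖ` in the standard coordinates. -/
lemma hasOrthogonalRoots_of_entries {p q : ℤ} (hpq : p * q = 2)
    (hA : ∀ i j : Fin m, A i j = if i = j then 2
      else if (i : ℕ) + 1 = j then (if (j : ℕ) = m - 1 then -p else -1)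
      else if (j : ℕ) + 1 = i then (if (i : ℕ) = m - 1 then -q else -1) else 0) :
    HasOrthogonalRoots A := by
  let row : Fin m → Fin m → ℤ := fun k j =>
    if (j : ℕ) = k then (if (k : ℕ) = m - 1 then 2 else q) else if (j : ℕ) + 1 = k then -q else 0
  refine ⟨Fin.val, Fin.val_injective, fun k => ⟨row k, ?_, fun j hj => ?_⟩⟩
  · obtain ⟨d, hd⟩ : ∃ d, (k : ℕ) + d + 1 = m := ⟨m - 1 - k, by lia⟩
    induction d generalizing k with
    | zero =>
      have : row k = A k := by
        funext j
        rw [hA]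
        simp only [row, Fin.ext_iff]
        grind
      rw [this]
      exact .simple k (show (k : ℕ) ≤ k from le_rfl)
    | succ d ih =>
      have hk : (k : ℕ) + 1 < m := by lia
      have h := ih ⟨k + 1, hk⟩ (by simp only; lia)
      have h' : IsReachable A {t | (k : ℕ) ≤ t} (row ⟨k + 1, hk⟩) :=
        h.mono fun t ht => le_trans (Nat.le_succ k) ht
      have : row k = fun j => row ⟨k + 1, hk⟩ j - row ⟨k + 1, hk⟩ k * A k j := by
        funext j
        rw [hA]
        simp only [row, Fin.ext_iff]
        grind
      rw [this]
      exact .reflect k (show (k : ℕ) ≤ k from le_rfl) h'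
  · simp only [row]
    grind

lemma IsTriple.ne {α β ω : Fin m} (h : IsTriple A α β ω) : α ≠ ω := by
  cases h with
  | typeB m hm => simp only [ne_eq, Fin.ext_iff]; lia
  | typeB3 => decide
  | typeC m k hk => simp
  | typeF4 => decide
  | typeG2 => decide

lemma isPath_B (m : ℕ) : IsPath (CartanMatrix.B m) := by
  intro i j hij
  simp only [CartanMatrix.B, Matrix.of_apply, Fin.ext_iff]
  grind

lemma isPath_C (m : ℕ) : IsPath (CartanMatrix.C m) := by
  intro i j hij
  simp only [CartanMatrix.C, Matrix.of_apply, Fin.ext_iff]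
  grind

lemma IsTriple.isPath {α β ω : Fin m} (h : IsTriple A α β ω) : IsPath A := by
  cases h with
  | typeB m hm => exact isPath_B m
  | typeB3 => exact isPath_B 3
  | typeC m k hk => exact isPath_C m
  | typeF4 =>
    intro i j hij
    fin_cases i <;> fin_cases j <;>
      first | exact absurd hij (by decide) | exact ⟨by decide, by decide⟩
  | typeG2 =>
    intro i j hij
    fin_cases i <;> fin_cases j <;>
      first | exact absurd hij (by decide) | exact ⟨by decide, by decide⟩

lemma hasOrthogonalRoots_B (m : ℕ) : HasOrthogonalRoots (CartanMatrix.B m) := by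
  refine hasOrthogonalRoots_of_entries (p := 2) (q := 1) (by norm_num) fun i j => ?_
  simp only [CartanMatrix.B, Matrix.of_apply, Fin.ext_iff]
  grind

lemma hasOrthogonalRoots_C (m : ℕ) : HasOrthogonalRoots (CartanMatrix.C m) := by
  refine hasOrthogonalRoots_of_entries (p := 1) (q := 2) (by norm_num) fun i j => ?_
  simp only [CartanMatrix.C, Matrix.of_apply, Fin.ext_iff]
  grind

lemma IsTriple.hasOrthogonalRoots {α β ω : Fin m} (h : IsTriple A α β ω) :
    HasOrthogonalRoots A := by
  cases h with
  | typeB m hm => exact hasOrthogonalRoots_B m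
  | typeB3 => exact hasOrthogonalRoots_B 3
  | typeC m k hk => exact hasOrthogonalRoots_C m
  | typeF4 =>
    refine ⟨![1, 2, 3, 0], by decide, fun k => ?_⟩
    fin_cases k
    · exact ⟨_, .reflect 0 (by decide) (.reflect 1 (by decide) (.simple 2 (by decide))), by decide⟩
    · exact ⟨_, .reflect 1 (by decide) (.simple 2 (by decide)), by decide⟩
    · exact ⟨_, .simple 2 (by decide), by decide⟩
    · exact ⟨_, .reflect 3 (by decide) (.reflect 2 (by decide) (.reflect 1 (by decide)
        (.reflect 0 (by decide) (.reflect 2 (by decide) (.reflect 1 (by decide)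
        (.reflect 2 (by decide) (.simple 3 (by decide)))))))), by decide⟩
  | typeG2 =>
    refine ⟨![0, 1], by decide, fun k => ?_⟩
    fin_cases k
    · exact ⟨_, .reflect 0 (by decide) (.reflect 1 (by decide) (.simple 0 (by decide))), by decide⟩
    · exact ⟨_, .simple 1 (by decide), by decide⟩

end CartanMatrix

/-- If there are as many pairwise orthogonal roots as the rank, the product of their reflections
is `-1`. -/
theorem negOneMemWeyl_of_orthogonal {ι : Type*} [Fintype ι] (r : ι → H.root)
    (hr : Pairwise fun k l => (rootSystem H).pairing (r k) (r l) = 0)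
    (hcard : Fintype.card ι = Module.finrank ℂ (Module.Dual ℂ H)) : NegOneMemWeyl H := by
  classical
  intro X hX χ hχ
  have horth (k l : ι) : (rootSystem H).root (r k) ((rootSystem H).coroot (r l)) =
      if k = l then 2 else 0 := by
    split_ifs with h
    · rw [h]
      exact (rootSystem H).root_coroot_two (r l)
    · exact hr h
  have hmem (s : Finset ι) : χ - ∑ k ∈ s, χ ((rootSystem H).coroot (r k)) •
      (rootSystem H).root (r k) ∈ X := by
    induction s using Finset.induction_on with
    | empty => simpa using hχ
    | insert i s hi ih =>
      have := hX (r i) _ ih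
      convert this using 1
      have h0 : (∑ k ∈ s, χ ((rootSystem H).coroot (r k)) • (rootSystem H).root (r k))
          ((rootSystem H).coroot (r i)) = 0 := by
        rw [LinearMap.sum_apply]
        refine Finset.sum_eq_zero fun k hk => ?_
        rw [LinearMap.smul_apply, horth, if_neg (by rintro rfl; exact hi hk), smul_zero]
      rw [RootPairing.reflection_apply, Finset.sum_insert hi]
      change _ = _ - ((χ - _) ((rootSystem H).coroot (r i))) • _
      rw [LinearMap.sub_apply, h0, sub_zero]
      abel
  have hli : LinearIndependent ℂ fun k => (rootSystem H).root (r k) := by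
    rw [Fintype.linearIndependent_iff]
    intro c hc l
    have := LinearMap.congr_fun hc ((rootSystem H).coroot (r l))
    rw [LinearMap.sum_apply] at this
    simpa only [LinearMap.smul_apply, horth, smul_eq_mul, mul_ite, mul_zero, Finset.sum_ite_eq',
      Finset.mem_univ, if_true, LinearMap.zero_apply, mul_eq_zero, two_ne_zero, or_false] using this
  have hspan := hli.span_eq_top_of_card_eq_finrank' hcard
  have heq : LinearMap.id (R := ℂ) (M := Module.Dual ℂ H) + LinearMap.id =
      ∑ k, (Module.Dual.eval ℂ H ((rootSystem H).coroot (r k))).smulRight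
        ((rootSystem H).root (r k)) := by
    refine LinearMap.ext_on_range hspan fun l => ?_
    rw [LinearMap.sum_apply, Finset.sum_eq_single l]
    · rw [LinearMap.smulRight_apply, Module.Dual.eval_apply, horth, if_pos rfl, two_smul]
      rfl
    · intro k _ hk
      rw [LinearMap.smulRight_apply, Module.Dual.eval_apply, horth, if_neg hk.symm, zero_smul]
    · intro h
      exact absurd (Finset.mem_univ l) h
  have h1 := LinearMap.congr_fun heq χ
  rw [LinearMap.sum_apply] at h1
  have h2 : χ - ∑ k, χ ((rootSystem H).coroot (r k)) • (rootSystem H).root (r k) = -χ := by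
    have h3 : χ + χ = ∑ k, χ ((rootSystem H).coroot (r k)) • (rootSystem H).root (r k) := h1
    rw [← h3]
    abel
  exact h2 ▸ hmem Finset.univ

lemma pairing_reflectionPerm_left (i j k : H.root) :
    (rootSystem H).pairing ((rootSystem H).reflectionPerm i j) k =
      (rootSystem H).pairing j k -
        (rootSystem H).pairing j i * (rootSystem H).pairing i k := by
  change (rootSystem H).root ((rootSystem H).reflectionPerm i j) ((rootSystem H).coroot k) = _
  rw [RootPairing.root_reflectionPerm, RootPairing.reflection_apply_root]
  rfl

section Base

variable (b : (rootSystem H).Base) {m : ℕ} {A : Matrix (Fin m) (Fin m) ℤ} (e : Fin m ≃ b.support)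
  (hA : ∀ i j, b.cartanMatrix (e i) (e j) = A i j)
include hA

lemma pairing_eq (i j : Fin m) : (rootSystem H).pairing (e i) (e j) = A i j := by
  rw [← hA, ← (rootSystem H).algebraMap_pairingIn ℤ]
  rfl

lemma IsReachable.exists_root {S : Set (Fin m)} {a : Fin m → ℤ} (ha : IsReachable A S a) :
    ∃ r : H.root, (∀ j, (rootSystem H).pairing r (e j) = a j) ∧
      ∀ i, (∀ t ∈ S, (rootSystem H).pairing i (e t) = 0) → (rootSystem H).pairing i r = 0 := by
  induction ha with
  | simple t ht => exact ⟨e t, fun j => pairing_eq b e hA t j, fun i hi => hi t ht⟩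
  | @reflect i hi a _ ih =>
    obtain ⟨r, hr, hr'⟩ := ih
    refine ⟨(rootSystem H).reflectionPerm (e i) r, fun j => ?_, fun k hk => ?_⟩
    · rw [pairing_reflectionPerm_left, hr, hr, pairing_eq b e hA]
      push_cast
      rfl
    · rw [RootPairing.pairing_reflectionPerm]
      refine hr' _ fun t ht => ?_
      rw [pairing_reflectionPerm_left, hk t ht, hk i hi, zero_mul, sub_zero]

theorem HasOrthogonalRoots.negOneMemWeyl (h : HasOrthogonalRoots A) : NegOneMemWeyl H := by
  obtain ⟨ρ, hρ, h⟩ := h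
  choose a ha ha' using h
  choose r hr hr' using fun k => (ha k).exists_root b e hA
  have hlt {k l : Fin m} (hkl : ρ k < ρ l) : (rootSystem H).pairing (r k) (r l) = 0 :=
    hr' l (r k) fun t ht => by rw [hr, ha' k t (lt_of_lt_of_le hkl ht), Int.cast_zero]
  refine negOneMemWeyl_of_orthogonal r (fun k l hkl => ?_) ?_
  · rcases lt_or_gt_of_ne (hρ.ne hkl) with h | h
    · exact hlt h
    · exact (rootSystem H).pairing_eq_zero_iff.1 (hlt h)
  · rw [Module.finrank_eq_card_basis b.toWeightBasis, Fintype.card_congr e]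

theorem IsPath.isIrreducible (h : IsPath A) (i₀ : Fin m) : IsIrreducible ℂ 𝔩 𝔩 := by
  have : Nonempty b.support := ⟨e i₀⟩
  refine isIrreducible_of_connected b fun p hp hstep => ?_
  have hstep' : ∀ i j : Fin m, A j i ≠ 0 → p (e i) → p (e j) := fun i j hij hi =>
    hstep _ _ hi (by rwa [hA])
  obtain ⟨i, hi⟩ := hp
  obtain ⟨i, rfl⟩ := e.surjective i
  have hup (d : ℕ) (hd : i + d < m) : p (e ⟨i + d, hd⟩) := by
    induction d with
    | zero => exact hi
    | succ d ih => exact hstep' ⟨i + d, by lia⟩ _ (h _ _ rfl).2 (ih _)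
  have hdown (d : ℕ) (hd : d ≤ i) : p (e ⟨i - d, by lia⟩) := by
    induction d with
    | zero => exact hi
    | succ d ih => exact hstep' ⟨i - d, by lia⟩ _ (h _ _ (by simp only; lia)).1 (ih (by lia))
  intro j
  obtain ⟨j, rfl⟩ := e.surjective j
  rcases le_total (i : ℕ) j with hij | hij
  · have := hup (j - i) (by lia)
    convert this
    lia
  · have := hdown (i - j) (by lia)
    convert this
    lia

end Base

end Orthogonal

end

end Horospherical

theorem mainTheorem9
    {m : ℕ} {A : Matrix (Fin m) (Fin m) ℤ} {α β ω : Fin m}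
    (hX : Horospherical.IsTriple A α β ω)
    {𝔩 : Type*} [LieRing 𝔩] [LieAlgebra ℂ 𝔩] [FiniteDimensional ℂ 𝔩]
    [LieAlgebra.IsSemisimple ℂ 𝔩]
    (H : LieSubalgebra ℂ 𝔩) [H.IsCartanSubalgebra]
    (b : (LieAlgebra.IsKilling.rootSystem H).Base) (e : Fin m ≃ b.support)
    (hA : ∀ i j, b.cartanMatrix (e i) (e j) = A i j)
    {U : Type*} [AddCommGroup U] [Module ℂ U] [FiniteDimensional ℂ U]
    [LieRingModule 𝔩 U] [LieModule ℂ 𝔩 U]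
    (hU : Horospherical.IsFundamentalRep b (e ω) U) :
    let E : H := Horospherical.charElt b (e α)
    let g : ℤ → Submodule ℂ (Horospherical.Aut 𝔩 U) := Horospherical.gPart U E
    -- the graded Lie algebra `𝔤`
    Horospherical.IsGradation g ∧
    -- (1)
    Horospherical.IsFundamental g ∧
    -- (2)
    (∀ z ∈ Horospherical.luNonneg U E,
      (∀ x ∈ Horospherical.lPart E (-1), ⁅z, Horospherical.inL 𝔩 U x⁆ = 0) → z = 0) ∧
    (∀ z ∈ Horospherical.gNonneg U E, (∀ x ∈ g (-1), ⁅z, x⁆ = 0) → z = 0) ∧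
    -- (3)
    (∀ u ∈ Horospherical.uTilde U E 0, u ≠ 0 →
      Submodule.span ℂ {y : U | ∃ x ∈ Horospherical.lPart E (-1), ⁅x, u⁆ = y} ≤
        Horospherical.uTilde U E (-1) ∧
      2 ≤ Module.finrank ℂ
        (Submodule.span ℂ {y : U | ∃ x ∈ Horospherical.lPart E (-1), ⁅x, u⁆ = y})) := by
  open Horospherical in
  intro E g
  have hirr := hX.isPath.isIrreducible b e hA α
  have hneg := hX.hasOrthogonalRoots.negOneMemWeyl b e hA
  have := hU.1
  obtain ⟨ϖ, hϖ, hϖω, hϖj⟩ := exists_isHighestWeight b hU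
  have hϖ0 : ϖ ≠ 0 := by
    rintro rfl
    exact zero_ne_one hϖω
  have hϖα : ϖ ((LieAlgebra.IsKilling.rootSystem H).coroot (e α)) = 0 :=
    hϖj _ (e.injective.ne hX.ne)
  have hu (i : ℤ) : uTilde U E i = eig U E (-ϖ E + 1 + i) := hϖ.uTilde_eq (e α) hneg hirr hϖ0 i
  have hbot : ∀ i < -1, uTilde U E i = ⊥ := by
    intro i hi
    rw [hu, ← hϖ.eig_neg_sub_eq_bot (e α) hneg (n := -1 - i) (by lia)]
    congr 1
    push_cast
    ring
  have hu1 : uTilde U E (-1) = eig U E (-ϖ E) := by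
    rw [hu]
    congr 1
    push_cast
    ring
  have hutop : ⨆ i : ℤ, uTilde U E i = ⊤ := by
    rw [eq_top_iff, ← hϖ.iSup_eig_neg_add_eq_top (e α) hneg]
    refine iSup_le fun n => le_iSup_of_le ((n : ℤ) - 1) (le_of_eq ?_)
    rw [hu]
    congr 1
    push_cast
    ring
  have hlow : lowKer U E ≤ uTilde U E (-1) := hu1 ▸ hϖ.lowKer_le_eig (e α) hneg
  have hdis := disjoint_lowKer_iSup_lPart (e α) hirr
  have hgrad : IsGradation g := isGradation_gPart (iSup_lPart_charElt b (e α)) hbot hutop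
  refine ⟨hgrad, ⟨hgrad.exists_isNilpotent, fun p hp => ?_⟩, fun z hz h => ?_, fun z hz h => ?_,
    fun u hu0 hne => ⟨?_, ?_⟩⟩
  · exact gPart_eq_bracketSpan hbot hp (lPart_le_bracketSpan b (e α) hp)
  · exact eq_zero_of_mem_luNonneg hdis hlow hz h
  · refine eq_zero_of_mem_gNonneg hdis hlow hbot ?_ hz h
    rw [hu1]
    exact eig_neg_ne_bot hneg hϖ.weightSpace_ne_bot E (hϖ.eig_ne_bot E)
  · rw [Submodule.span_le]
    rintro _ ⟨x, hx, rfl⟩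
    rw [hu] at hu0
    have := lie_mem_eig hx hu0
    have h0 : -ϖ E + 1 + ((0 : ℤ) : ℂ) + ((-1 : ℤ) : ℂ) = -ϖ E := by
      push_cast
      ring
    rw [h0] at this
    rw [hu1]
    exact this
  · by_contra hlt
    have hu0' : u ∈ eig U E (-ϖ E + 1) := by
      rw [hu] at hu0
      simpa using hu0
    refine not_rankLeOne hϖ hneg (e α) hϖα hu0' hne ?_
    obtain ⟨w, hw⟩ := (finrank_le_one_iff).1 (Nat.le_of_lt_succ (not_le.1 hlt))
    refine ⟨w, fun x hx => ?_⟩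
    obtain ⟨c, hc⟩ := hw ⟨⁅x, u⁆, Submodule.subset_span ⟨x, hx, rfl⟩⟩
    exact ⟨c, congrArg Subtype.val hc.symm⟩
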